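/- \textbf{Conventions.} "Quasilocal" means having a unique maximal ideal; "local" means Noetherian and quasilocal; natural numbers are positive; a DVR is not a field. An extension of commutative rings $A\subseteq B$ is a \emph{root extension} if for each $b\in B$ there is a natural number $n=n(b)$ with $b^n\in A$, and a \emph{bounded root extension} if one $n$ works for all $b\in B$. A domain $A$ is an \emph{AV-domain} (almost valuation domain) if for all nonzero $a,b\in A$ there is a natural number $n$ with $a^n\mid b^n$ or $b^n\mid a^n$. It is an \emph{API-domain} (almost principal ideal domain) if for each nonempty set $\{a_\alpha\}$ of nonzero elements of $A$ there is a natural number $n$ such that the ideal $(\{a_\alpha^n\})$ is principal. It is a \emph{RAV-domain} (rational almost valuation domain) if it is not a field and there is $a\in A$ such that for each nonzero nonunit $y\in A$ there are natural numbers $m,n$ and a unit $u$ of $A$ with $y^m=ua^n$. A \emph{rational valuation domain} is a valuation domain whose value group is order-isomorphic to a subgroup of $(\mathbb{Q},+)$. \textbf{Theorem.} Let $(V,M)$ be a valuation domain, not a field (that is, $M\neq 0$), with quotient field $L$, of the form $V=K+M$ where $K$ is a subfield of $V$. Let $D$ be a subring of $K$ with quotient field $F\subseteq K$, let $\widetilde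 D$ be the integral closure of $D$ in $K$, and let $R=D+M$. Then $R$ is a subring of $V$ with quotient field $L$. Let $\overline R$ be the integral closure of $R$ in $L$. \begin{enumerate} \item[(1)] $R=V$ if and only if $D=K$. If $R\subsetneq V$, then $[R:V]:=\{x\in L\mid xV\subseteq R\}=M$. \item[(2)] $\overline R=\widetilde D+M$. \item[(3)] $R$ is quasilocal if and only if $D$ is quasilocal. \item[(4)] The following are equivalent: $R$ is local; $R$ is Noetherian; $V$ is a DVR, $D=F$ is a field and $[K:F]<\infty$. \item[(5)] $R$ is a valuation domain if and only if $D$ is a valuation domain and $K=F$. \item[(6)] The following are equivalent: $R$ is a DVR (resp., rational valuation domain); $D=K$ and $V$ is a DVR (resp., rational valuation domain); $R=V$ is a DVR (resp., rational valuation domain). \item[(7)] $R\subseteq\overline R$ is a root extension (resp., bounded root extension) if and only if $D\subseteq\widetilde D$ is a root extension (resp., bounded root extension). \item[(8)] The following are equivalent: $R$ is an AV-domain; $\widetilde D$ is a valuation domain with quotient field $K$ and $D\subseteq\widetilde D$ is a root extension; $D$ is an AV-domain and $F\subseteq K$ is a root extension. Moreover, $F\subseteq K$ is a root extension if and only if $K$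 is purely inseparable over $F$ or $K$ is algebraic over a finite field. \item[(9)] The following are equivalent: (a) $R$ is an AV-domain and $\overline R$ is a DVR; (b) $R$ is a quasilocal AV-domain whose maximal ideal $Q$ satisfies $\bigcap_{n=1}^\infty Q^n=0$; (c) $R$ is a quasilocal AV-domain with maximal ideal $Q$ such that for each ideal $A$ of $R$ with $0\subsetneq A\subsetneq R$ there is a natural number $n$ with $Q^n\subseteq A$; (d) $V$ is a DVR, $D=F$ is a field and $F\subseteq K$ is a root extension. In case (a), necessarily $\overline R=V$. \item[(10)] $R$ is a local AV-domain if and only if $V$ is a DVR, $D=F$ is a field with $[K:F]<\infty$, and $F\subseteq K$ is a root extension. \item[(11)] $R$ is a quasilocal API-domain if and only if $V$ is a DVR, $D=F$ is a field and $F\subseteq K$ is a bounded root extension. Moreover, $F\subseteq K$ is a bounded root extension if and only if $K$ is purely inseparable over $F$ of bounded exponent (that is, $K=F$, or $\operatorname{char}F=p>0$ and $K^{p^n}\subseteq F$ for some $n$) or $K$ is finite. \item[(12)] $R$ is a local API-domain if and only if $V$ is a DVR, $D=F$ is a field with $[K:F]<\infty$, and $F\subseteq K$ is a bounded root extension. \item[(13)]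 $R$ is a RAV-domain if and only if $V$ is a rational valuation domain, $D=F$ is a field, and $F\subseteq K$ is a root extension. \end{enumerate} -/

import Mathlib

/-- For a valuation ring `V` of the field `L` with maximal ideal `M`, a field `K` embedded in `V`,
and a subring `A` of `K`, the subring `A + M` of `L`. -/
def plusMaxIdeal {K L : Type*} [Field K] [Field L] [Algebra K L] (V : ValuationSubring L)
    (hKV : ∀ k : K, algebraMap K L k ∈ V) (A : Subring K) : Subring L where
  carrier := {x | ∃ a ∈ A, ∃ m ∈ IsLocalRing.maximalIdeal V, x = algebraMap K L a + (m : L)}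
  zero_mem' := ⟨0, A.zero_mem, 0, Ideal.zero_mem _, by simp⟩
  one_mem' := ⟨1, A.one_mem, 0, Ideal.zero_mem _, by simp⟩
  add_mem' := by
    rintro _ _ ⟨a, ha, m, hm, rfl⟩ ⟨b, hb, n, hn, rfl⟩
    exact ⟨a + b, A.add_mem ha hb, m + n, Ideal.add_mem _ hm hn, by push_cast; ring⟩
  neg_mem' := by
    rintro _ ⟨a, ha, m, hm, rfl⟩
    exact ⟨-a, A.neg_mem ha, -m, neg_mem hm, by push_cast; ring⟩
  mul_mem' := by
    rintro _ _ ⟨a, ha, m, hm, rfl⟩ ⟨b, hb, n, hn, rfl⟩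
    refine ⟨a * b, A.mul_mem ha hb,
      ⟨algebraMap K L a, hKV a⟩ * n + ⟨algebraMap K L b, hKV b⟩ * m + m * n,
      Ideal.add_mem _ (Ideal.add_mem _ (Ideal.mul_mem_left _ _ hn) (Ideal.mul_mem_left _ _ hm))
        (Ideal.mul_mem_left _ _ hn), ?_⟩
    push_cast
    ring

/-- The conductor `[A : B] = {x | x B ⊆ A}` of two subrings of a field (taken in the field;
as `1 ∈ B`, it lies in `A`). -/
def conductorSet {L : Type*} [Field L] (A B : Subring L) : Set L :=
  {x | ∀ b ∈ B, x * b ∈ A}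

/-- `A ⊆ B` is a root extension: every `b ∈ B` has a positive power in `A`. It is applied only
to inclusions. -/
def IsRootExtension (A B : Type*) [CommRing A] [CommRing B] [Algebra A B] : Prop :=
  ∀ b : B, ∃ n : ℕ, 0 < n ∧ b ^ n ∈ (algebraMap A B).range

/-- `A ⊆ B` is a bounded root extension: one positive exponent works for all `b ∈ B`. -/
def IsBoundedRootExtension (A B : Type*) [CommRing A] [CommRing B] [Algebra A B] : Prop :=
  ∃ n : ℕ, 0 < n ∧ ∀ b : B, b ^ n ∈ (algebraMap A B).range

/-- Almost valuation domains. -/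
def IsAVDomain (A : Type*) [CommRing A] [IsDomain A] : Prop :=
  ∀ a b : A, a ≠ 0 → b ≠ 0 → ∃ n : ℕ, 0 < n ∧ (a ^ n ∣ b ^ n ∨ b ^ n ∣ a ^ n)

/-- Almost principal ideal domains: for every nonempty set `S` of nonzero elements, some
`({s ^ n | s ∈ S})` with `n ≥ 1` is principal. -/
def IsAPIDomain (A : Type*) [CommRing A] [IsDomain A] : Prop :=
  ∀ S : Set A, S.Nonempty → (∀ s ∈ S, s ≠ 0) →
    ∃ n : ℕ, 0 < n ∧ (Ideal.span ((fun s : A => s ^ n) '' S)).IsPrincipal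

/-- Almost uniformizing parameters: every nonzero nonunit `y` satisfies `y ^ m = u * a ^ n`
with `m, n ≥ 1` and `u` a unit. -/
def IsAlmostUniformizingParameter {A : Type*} [CommRing A] [IsDomain A] (a : A) : Prop :=
  ∀ y : A, y ≠ 0 → ¬ IsUnit y → ∃ m n : ℕ, 0 < m ∧ 0 < n ∧ ∃ u : Aˣ, y ^ m = u * a ^ n

/-- Rational almost valuation domains: domains that are not fields and have an almost
uniformizing parameter. -/
def IsRAVDomain (A : Type*) [CommRing A] [IsDomain A] : Prop :=
  ¬ IsField A ∧ ∃ a : A, IsAlmostUniformizingParameter a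

/-- Rational valuation domains: valuation domains whose value group is order-isomorphic to a
subgroup of `(ℚ, +)`. The units of `ValuationRing.ValueGroup` are the (multiplicatively written)
value group with the reverse of the additive order; negation shows that the reversal does not
affect being order-isomorphic to a subgroup of `ℚ`. -/
def IsRationalValuationDomain (A : Type*) [CommRing A] [IsDomain A] : Prop :=
  ∃ _ : ValuationRing A, ∃ H : AddSubgroup ℚ,
    Nonempty ((ValuationRing.ValueGroup A (FractionRing A))ˣ ≃*o Multiplicative H)

/-- Local rings in the sense "Noetherian with a unique maximal ideal" (a ring that need only have
a unique maximal ideal is called quasilocal; this is `IsLocalRing`). -/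
def IsNoetherianLocal (A : Type*) [CommRing A] : Prop :=
  IsNoetherianRing A ∧ IsLocalRing A

/-! Since V = K + M, the field K maps isomorphically onto V/M. This gives a retraction π : V → K
with kernel M, and R = D + M is the preimage of D under π (`IsCoefficientPullback`). Two facts then
carry most of the proof. As M ⊆ R, an element of L of valuation other than 1 lies in R or has its
inverse there, so comparing elements of R by divisibility reduces to units of V, which π sends to K.
Conversely, for a fixed nonzero m ∈ M, multiplication by m moves K, and even V, into R. Hence a
property of R can be tested on elements mk with k ∈ K, whose quotients are arbitrary elements of K.

The integral closure of R is the preimage of the integral closure of D under the same π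
(`pullback_integralClosure`), so whatever is proved for a general D also applies to it. The AV
property of R says that each nonzero k ∈ K has some k ^ n or k⁻¹ ^ n in D; two lemmas on subrings of
fields translate this into the two stated conditions on D. The Noetherian and API conditions, the
RAV condition, and the condition on powers of the maximal ideal each force D to be a field:
otherwise a nonunit of D would divide elements of M infinitely often, or would be comparable to none
of them.

The description of root extensions of fields is a separate argument. If K is not purely inseparable
over F, some α ∉ F has a conjugate β ≠ α, and all (β + x) / (α + x) with x ∈ F are roots of unity.
Characteristic zero is excluded because a number field has finitely many roots of unity; in
characteristic p, two of these ratios already make α algebraic over the prime field. If the exponent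
is bounded, the ratios are zeros of one polynomial and F is finite. -/

/-! ### Root extensions of fields -/

-- Take α separable over F and outside F, and β another root of its minimal polynomial. If (α + x) ^
-- n = c ∈ F, the minimal polynomial divides (X + x) ^ n - c, so β satisfies the same equation.
open Polynomial in
theorem exists_conjugate_pow_eq_of_not_isPurelyInseparable (F K : Type*) [Field F] [Field K]
    [Algebra F K] [Algebra.IsAlgebraic F K] (h : ¬ IsPurelyInseparable F K) :
    ∃ α : K, α ∉ (algebraMap F K).range ∧ ∃ β : AlgebraicClosure K,
      β ≠ algebraMap K (AlgebraicClosure K) α ∧ ∀ (x : F) (n : ℕ),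
        (α + algebraMap F K x) ^ n ∈ (algebraMap F K).range →
          (β + algebraMap F _ x) ^ n =
            (algebraMap K (AlgebraicClosure K) α + algebraMap F _ x) ^ n := by
  rw [isPurelyInseparable_iff] at h
  push Not at h
  obtain ⟨α, hα⟩ := h
  obtain ⟨hsep, hα⟩ := hα (Algebra.IsIntegral.isIntegral α)
  have hint : IsIntegral F α := Algebra.IsIntegral.isIntegral α
  refine ⟨α, hα, ?_⟩
  set Ω := AlgebraicClosure K
  have hcard := card_rootSet_eq_natDegree (K := Ω) hsep
    (IsAlgClosed.splits ((minpoly F α).map (algebraMap F Ω)))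
  have hdeg : 1 < (minpoly F α).natDegree := by
    have h0 := minpoly.natDegree_pos hint
    have h1 := mt minpoly.natDegree_eq_one_iff.mp hα
    omega
  have hroot : algebraMap K Ω α ∈ (minpoly F α).rootSet Ω := by
    rw [mem_rootSet]
    exact ⟨minpoly.ne_zero hint, by rw [aeval_algebraMap_apply, minpoly.aeval, map_zero]⟩
  obtain ⟨⟨β, hβ⟩, hne⟩ := Fintype.exists_ne_of_one_lt_card (hcard ▸ hdeg) ⟨_, hroot⟩
  refine ⟨β, fun e => hne (Subtype.ext e), ?_⟩
  rintro x n ⟨c, hc⟩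
  have hd : minpoly F α ∣ (X + C x) ^ n - C c := minpoly.dvd _ _ (by simp [hc])
  have h1 := aeval_eq_zero_of_dvd_aeval_eq_zero hd (mem_rootSet.mp hβ).2
  have h2 : aeval (algebraMap K Ω α) ((X + C x) ^ n - C c) = 0 :=
    aeval_eq_zero_of_dvd_aeval_eq_zero hd (mem_rootSet.mp hroot).2
  simp only [map_sub, map_pow, map_add, aeval_X, aeval_C] at h1 h2
  rw [sub_eq_zero.mp h1, sub_eq_zero.mp h2]

/-- If `b / a` and `(b + 1) / (a + 1)` are roots of unity and `a ≠ b`, then `a` is algebraic over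
every subfield. -/
theorem isAlgebraic_of_pow_eq_pow (k : Type*) {Ω : Type*} [Field k] [Field Ω] [Algebra k Ω]
    {a b : Ω} (hab : b ≠ a) (ha : a ≠ 0) (ha1 : a + 1 ≠ 0) {n m : ℕ} (hn : 0 < n) (hm : 0 < m)
    (h0 : b ^ n = a ^ n) (h1 : (b + 1) ^ m = (a + 1) ^ m) :
    a ∈ algebraicClosure k Ω := by
  have key : ∀ (w : Ω) (j : ℕ), 0 < j → w ^ j = 1 → w ∈ algebraicClosure k Ω := by
    intro w j hj hw
    rw [mem_algebraicClosure_iff]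
    exact (IsIntegral.of_pow hj (hw ▸ isIntegral_one)).isAlgebraic
  have hu := key (b / a) n hn (by rw [div_pow, h0, div_self (pow_ne_zero _ ha)])
  have hv := key ((b + 1) / (a + 1)) m hm (by rw [div_pow, h1, div_self (pow_ne_zero _ ha1)])
  have hne : b / a - (b + 1) / (a + 1) ≠ 0 := by
    rw [sub_ne_zero, Ne, div_eq_div_iff ha ha1]
    intro h
    exact hab (by linear_combination h)
  -- With u = b / a and v = (b + 1) / (a + 1), the relation u a + 1 = v (a + 1) is linear in a; u ≠
  -- v because a ≠ b.
  have : a = ((b + 1) / (a + 1) - 1) / (b / a - (b + 1) / (a + 1)) := by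
    rw [eq_div_iff hne]
    field_simp
    ring
  rw [this]
  exact div_mem (sub_mem hv (one_mem _)) (sub_mem hu hv)

-- The indices 0 and 1 make a and b algebraic over ℚ. The ratios (b + i) / (a + i) are then
-- infinitely many distinct roots of unity in one number field, which is impossible.
open IntermediateField in
theorem not_forall_exists_pow_eq_pow_of_charZero {Ω : Type*} [Field Ω] [CharZero Ω] {a b : Ω}
    (hab : b ≠ a) (ha : ∀ i : ℕ, a + i ≠ 0) :
    ¬ ∀ i : ℕ, ∃ n, 0 < n ∧ (b + i) ^ n = (a + i) ^ n := by
  intro h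
  obtain ⟨n, hn, h0⟩ := h 0
  obtain ⟨m, hm, h1⟩ := h 1
  have ha0 : a ≠ 0 := by simpa using ha 0
  have hA := isAlgebraic_of_pow_eq_pow ℚ hab ha0 (by simpa using ha 1) hn hm
    (by simpa using h0) (by simpa using h1)
  have hb : IsIntegral ℚ b := IsIntegral.of_pow hn (by
    have : b ^ n = a ^ n := by simpa using h0
    rw [this]
    exact (mem_algebraicClosure_iff.mp hA).isIntegral.pow n)
  have hA' : IsIntegral ℚ a := (mem_algebraicClosure_iff.mp hA).isIntegral
  have hfd : FiniteDimensional ℚ ℚ⟮a, b⟯ :=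
    finiteDimensional_adjoin fun x hx => by
      rcases hx with rfl | rfl
      exacts [hA', hb]
  have hnf : NumberField ℚ⟮a, b⟯ := ⟨⟩
  have hfin := NumberField.Embeddings.finite_of_norm_le ℚ⟮a, b⟯ ℂ 1
  let a' : ℚ⟮a, b⟯ := ⟨a, subset_adjoin _ _ (by simp)⟩
  let b' : ℚ⟮a, b⟯ := ⟨b, subset_adjoin _ _ (by simp)⟩
  have hne : ∀ i : ℕ, a' + i ≠ 0 := fun i e => ha i (by
    simpa [a'] using congrArg (Subtype.val) e)
  have hab' : b' ≠ a' := fun e => hab (congrArg Subtype.val e)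
  refine Set.infinite_of_injective_forall_mem (f := fun i : ℕ => (b' + i) / (a' + i))
    ?_ ?_ hfin
  · intro i j hij
    simp only at hij
    rw [div_eq_div_iff (hne i) (hne j)] at hij
    have h3 : (b' - a') * ((j : ℚ⟮a, b⟯) - i) = 0 := by linear_combination hij
    have := sub_eq_zero.mp ((mul_eq_zero.mp h3).resolve_left (sub_ne_zero.mpr hab'))
    exact_mod_cast this.symm
  · intro i
    obtain ⟨n, hn, h⟩ := h i
    have h' : ((b' + i) / (a' + i)) ^ n = 1 := by
      have : (b' + i) ^ n = (a' + i) ^ n := Subtype.ext (by simpa [a', b'] using h)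
      rw [div_pow, this, div_self (pow_ne_zero _ (hne i))]
    refine ⟨IsIntegral.of_pow hn (h' ▸ isIntegral_one), fun φ => ?_⟩
    exact (Complex.norm_eq_one_of_pow_eq_one (by rw [← map_pow, h', map_one]) hn.ne').le

theorem IsRootExtension.isAlgebraic {F K : Type*} [Field F] [Field K] [Algebra F K]
    (h : IsRootExtension F K) : Algebra.IsAlgebraic F K := by
  refine ⟨fun x => ?_⟩
  obtain ⟨n, hn, c, hc⟩ := h x
  exact (IsIntegral.of_pow hn (hc ▸ isIntegral_algebraMap)).isAlgebraic

theorem IsBoundedRootExtension.isRootExtension {A B : Type*} [CommRing A] [CommRing B]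
    [Algebra A B] (h : IsBoundedRootExtension A B) : IsRootExtension A B :=
  let ⟨n, hn, hb⟩ := h
  fun b => ⟨n, hn, hb b⟩

theorem add_algebraMap_notMem_range {F K : Type*} [Field F] [Field K] [Algebra F K]
    {α : K} (hα : α ∉ (algebraMap F K).range) (x : F) :
    α + algebraMap F K x ∉ (algebraMap F K).range := fun h =>
  hα (by simpa using sub_mem h (RingHom.mem_range_self (algebraMap F K) x))

theorem algebraMap_add_algebraMap_ne_zero {F K : Type*} [Field F] [Field K] [Algebra F K]
    {α : K} (hα : α ∉ (algebraMap F K).range) (x : F) :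
    algebraMap K (AlgebraicClosure K) α + algebraMap F _ x ≠ 0 := by
  rw [IsScalarTower.algebraMap_apply F K (AlgebraicClosure K), ← map_add, Ne, map_eq_zero]
  intro h
  exact add_algebraMap_notMem_range hα x (h ▸ zero_mem _)

/-- Kaplansky's theorem on root extensions of fields. -/
theorem isRootExtension_iff_isPurelyInseparable_or (K : Type*) [Field K] (F : Subfield K) :
    IsRootExtension F K ↔
      IsPurelyInseparable F K ∨ ∃ k : Subfield K, Finite k ∧ Algebra.IsAlgebraic k K := by
  constructor
  · intro h
    by_contra! hcon
    obtain ⟨hpi, hk⟩ := hcon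
    have := h.isAlgebraic
    obtain ⟨α, hα, β, hβ, hpow⟩ := exists_conjugate_pow_eq_of_not_isPurelyInseparable F K hpi
    obtain hchar | ⟨p, hp, hchar⟩ := CharP.exists' K
    · have : CharZero (AlgebraicClosure K) :=
        charZero_of_injective_algebraMap (algebraMap K (AlgebraicClosure K)).injective
      refine not_forall_exists_pow_eq_pow_of_charZero hβ (fun i => ?_) (fun i => ?_)
      · simpa using algebraMap_add_algebraMap_ne_zero hα (i : F)
      · obtain ⟨n, hn, hr⟩ := h (α + algebraMap F K i)
        exact ⟨n, hn, by simpa using hpow i n hr⟩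
    · have : CharP (AlgebraicClosure K) p :=
        charP_of_injective_algebraMap (algebraMap K (AlgebraicClosure K)).injective p
      let : Algebra (ZMod p) K := ZMod.algebra K p
      let : Algebra (ZMod p) F := ZMod.algebra F p
      let : Algebra (ZMod p) (AlgebraicClosure K) := ZMod.algebra _ p
      -- The elements x and x + 1 supply the two root-of-unity ratios. Subtracting the case x = 0
      -- then shows that F, and hence K, is algebraic over the prime field.
      have hmem : ∀ x : F, algebraMap K (AlgebraicClosure K) α + algebraMap F _ x ∈
          algebraicClosure (ZMod p) (AlgebraicClosure K) := by
        intro x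
        obtain ⟨n, hn, h0⟩ := h (α + algebraMap F K x)
        obtain ⟨m, hm, h1⟩ := h (α + algebraMap F K (x + 1))
        refine isAlgebraic_of_pow_eq_pow (ZMod p) (b := β + algebraMap F _ x)
          (fun e => hβ (add_right_cancel e)) (algebraMap_add_algebraMap_ne_zero hα x) ?_
          hn hm (hpow x n h0) ?_
        · simpa [add_assoc] using algebraMap_add_algebraMap_ne_zero hα (x + 1)
        · simpa [add_assoc] using hpow (x + 1) m h1
      have hF : ∀ x : F, IsAlgebraic (ZMod p) (x : K) := by
        intro x
        have h2 := sub_mem (hmem x) (hmem 0)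
        rw [map_zero, add_zero, add_sub_cancel_left,
          IsScalarTower.algebraMap_apply F K (AlgebraicClosure K),
          mem_algebraicClosure_iff] at h2
        exact (isAlgebraic_algebraMap_iff
          (algebraMap K (AlgebraicClosure K)).injective).mp h2
      let k : Subfield K := (algebraMap (ZMod p) K).fieldRange
      refine hk k ?_ ⟨fun x => ?_⟩
      · exact Set.finite_range (algebraMap (ZMod p) K)
      · obtain ⟨n, hn, c, hc⟩ := h x
        have h3 : IsIntegral (ZMod p) x := IsIntegral.of_pow hn (hc ▸ (hF c).isIntegral)
        obtain ⟨q, hq0, hq⟩ := h3.isAlgebraic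
        refine ⟨q.map (algebraMap (ZMod p) K).rangeRestrictField,
          (Polynomial.map_ne_zero_iff (RingHom.injective _)).mpr hq0, ?_⟩
        rw [Polynomial.aeval_def, Polynomial.eval₂_map]
        exact hq
  · rintro (h | ⟨k, hk, hK⟩) x
    · obtain ⟨n, hn⟩ := (isPurelyInseparable_iff_pow_mem F (ringExpChar F)).mp h x
      exact ⟨_, pow_pos (expChar_pos F _) n, hn⟩
    · by_cases hx : x = 0
      · exact ⟨1, one_pos, by simp [hx]⟩
      -- A nonzero x generates a finite field over k, so some power of x is 1.
      have hfd : FiniteDimensional k (IntermediateField.adjoin k {x}) :=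
        IntermediateField.adjoin.finiteDimensional (Algebra.IsIntegral.isIntegral x)
      have : Finite (IntermediateField.adjoin k {x}) := Module.finite_of_finite k
      obtain ⟨n, hn, h1⟩ := isOfFinOrder_iff_pow_eq_one.mp (isOfFinOrder_of_finite
        (Units.mk0 (⟨x, IntermediateField.mem_adjoin_simple_self k x⟩ :
          IntermediateField.adjoin k {x}) (fun e => hx (congrArg Subtype.val e))))
      refine ⟨n, hn, ?_⟩
      have : x ^ n = 1 := by
        have := congrArg (fun u => (((u : (IntermediateField.adjoin k {x})ˣ) :
          IntermediateField.adjoin k {x}) : K)) h1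
        simpa using this
      rw [this]
      exact one_mem _

open Polynomial in
open scoped Classical in
theorem isBoundedRootExtension_iff_hasExponent_or_finite (K : Type*) [Field K] (F : Subfield K) :
    IsBoundedRootExtension F K ↔
      (IsPurelyInseparable F K ∧ IsPurelyInseparable.HasExponent F K) ∨ Finite K := by
  constructor
  · intro h
    have halg := h.isRootExtension.isAlgebraic
    obtain ⟨n, hn, h⟩ := h
    by_cases hpi : IsPurelyInseparable F K
    · refine .inl ⟨hpi, ?_⟩
      let q := ringExpChar F
      rw [IsPurelyInseparable.hasExponent_iff' F K q]
      -- q ^ e is the exact power of q dividing n. By Bézout, x ^ n ∈ F and x ^ (q ^ j) ∈ F put x ^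
      -- gcd(n, q ^ j) in F, and this gcd divides q ^ e independently of x.
      obtain ⟨e, he⟩ : ∃ e, ∀ j, n.gcd (q ^ j) ∣ q ^ e := by
        rcases expChar_is_prime_or_one F q with hq | hq
        · obtain ⟨e, m, hm, rfl⟩ := Nat.exists_eq_pow_mul_and_not_dvd hn.ne' q hq.ne_one
          refine ⟨e, fun j => ?_⟩
          have : (q ^ j).Coprime m :=
            Nat.Coprime.pow_left _ ((Nat.Prime.coprime_iff_not_dvd hq).mpr hm)
          rw [Nat.gcd_comm, Nat.Coprime.gcd_mul_right_cancel_right _ this.symm]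
          exact Nat.gcd_dvd_right _ _
        · exact ⟨0, fun j => by simp [hq]⟩
      refine ⟨e, fun x => ?_⟩
      obtain ⟨j, hj⟩ := (isPurelyInseparable_iff_pow_mem F q).mp hpi x
      by_cases hx : x = 0
      · simp [hx, (expChar_pos F q).ne']
      obtain ⟨c, hc⟩ := he j
      rw [hc, pow_mul]
      refine pow_mem ?_ _
      have hrange : ∀ y : K, y ∈ (algebraMap F K).range ↔ y ∈ F := fun y =>
        ⟨fun ⟨z, hz⟩ => hz ▸ z.2, fun hy => ⟨⟨y, hy⟩, rfl⟩⟩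
      rw [hrange] at hj ⊢
      have hnx := (hrange _).mp (h x)
      rw [← zpow_natCast, Nat.gcd_eq_gcd_ab, zpow_add₀ hx, zpow_mul, zpow_mul, zpow_natCast,
        zpow_natCast]
      exact mul_mem (zpow_mem hnx _) (zpow_mem hj _)
    · right
      obtain ⟨α, hα, β, hβ, hpow⟩ := exists_conjugate_pow_eq_of_not_isPurelyInseparable F K hpi
      set a := algebraMap K (AlgebraicClosure K) α
      -- This polynomial vanishes on all of F, so F will be finite; its value at -a is (β - a) ^ n ≠
      -- 0.
      have hne : (C β + X) ^ n - (C a + X) ^ n ≠ 0 := by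
        intro h0
        have := congrArg (eval (-a)) h0
        simp only [eval_sub, eval_pow, eval_add, eval_C, eval_X, add_neg_cancel, eval_zero,
          zero_pow hn.ne', sub_zero] at this
        exact hβ (by linear_combination (eq_zero_of_pow_eq_zero this))
      have hFfin : Finite F := by
        refine Set.finite_univ_iff.mp (Set.Finite.of_finite_image
          (f := algebraMap F (AlgebraicClosure K))
          (Set.Finite.subset ((C β + X) ^ n - (C a + X) ^ n).roots.toFinset.finite_toSet ?_)
          (algebraMap F (AlgebraicClosure K)).injective.injOn)
        rintro _ ⟨x, -, rfl⟩
        simp only [Finset.mem_coe, Multiset.mem_toFinset]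
        rw [mem_roots hne]
        simpa [sub_eq_zero] using hpow x n (h _)
      have := Fintype.ofFinite F
      have hq := Fintype.one_lt_card (α := F)
      -- As x ^ n lies in the finite field F, every x ∈ K is a zero of this polynomial.
      have hne : (X ^ (n * Fintype.card F) - X ^ n : K[X]) ≠ 0 := by
        rw [sub_ne_zero]
        intro h0
        have := congrArg natDegree h0
        simp only [natDegree_X_pow] at this
        nlinarith
      refine Set.finite_univ_iff.mp (Set.Finite.subset
        (X ^ (n * Fintype.card F) - X ^ n : K[X]).roots.toFinset.finite_toSet fun x _ => ?_)
      simp only [Finset.mem_coe, Multiset.mem_toFinset]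
      rw [mem_roots hne]
      obtain ⟨c, hc⟩ := h x
      simp only [IsRoot, eval_sub, eval_pow, eval_X, sub_eq_zero, pow_mul]
      rw [← hc, ← map_pow, FiniteField.pow_card]
  · rintro (⟨-, h⟩ | h)
    · obtain ⟨e, he⟩ := (IsPurelyInseparable.hasExponent_iff F K).mp h
      exact ⟨_, pow_pos (expChar_pos F _) e, he⟩
    · have := Fintype.ofFinite K
      refine ⟨Fintype.card K - 1, Nat.sub_pos_of_lt Fintype.one_lt_card, fun x => ?_⟩
      by_cases hx : x = 0
      · simp [hx, (Nat.sub_pos_of_lt (Fintype.one_lt_card (α := K))).ne']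
      · rw [FiniteField.pow_card_sub_one_eq_one x hx]
        exact one_mem _

/-! ### Rational valuation domains and almost uniformizing parameters -/

/-- Powers of g are strictly ordered, so y ^ m = g ^ n determines the fraction n / m. Sending y to n
/ m is the required embedding into ℚ. -/
theorem exists_orderMonoidIso_multiplicative_addSubgroup_rat {G : Type*} [CommGroup G]
    [LinearOrder G] [IsOrderedMonoid G] {g : G} (hg : 1 < g)
    (h : ∀ y : G, 1 < y → ∃ m n : ℕ, 0 < m ∧ 0 < n ∧ y ^ m = g ^ n) :
    ∃ H : AddSubgroup ℚ, Nonempty (G ≃*o Multiplicative H) := by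
  have hmono := zpow_right_strictMono hg
  have hex : ∀ y : G, ∃ m : ℕ, 0 < m ∧ ∃ n : ℤ, y ^ m = g ^ n := by
    intro y
    rcases lt_trichotomy y 1 with hy | rfl | hy
    · obtain ⟨m, n, hm, -, e⟩ := h y⁻¹ (one_lt_inv'.mpr hy)
      refine ⟨m, hm, -n, ?_⟩
      rw [zpow_neg, zpow_natCast, ← e, inv_pow, inv_inv]
    · exact ⟨1, one_pos, 0, by simp⟩
    · obtain ⟨m, n, hm, -, e⟩ := h y hy
      exact ⟨m, hm, n, by rw [e, zpow_natCast]⟩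
  choose m hm n hn using hex
  have huniq : ∀ (y : G) (i : ℕ) (j : ℤ), 0 < i → y ^ i = g ^ j → (n y : ℚ) / m y = j / i := by
    intro y i j hi e
    have h1 : g ^ (n y * i) = g ^ (j * m y) := by
      rw [zpow_mul, zpow_mul, ← hn, ← e, zpow_natCast, zpow_natCast, ← pow_mul, ← pow_mul,
        mul_comm]
    have h2 := hmono.injective h1
    have := hm y
    rw [div_eq_div_iff (by positivity) (by positivity)]
    exact_mod_cast h2
  let f : G →* Multiplicative ℚ :=
    { toFun := fun y => Multiplicative.ofAdd ((n y : ℚ) / m y)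
      map_one' := by
        rw [huniq 1 1 0 one_pos (by simp)]
        simp
      map_mul' := fun x y => by
        have hx := hm x
        have hy := hm y
        rw [← ofAdd_add, huniq (x * y) (m x * m y) (n x * m y + n y * m x) (by positivity) ?_]
        · congr 1
          push_cast
          field_simp
        · rw [mul_pow, pow_mul, hn, mul_comm (m x), pow_mul, hn, zpow_add, zpow_mul, zpow_mul]
          simp }
  have hpos : ∀ y, 1 < y → 1 < f y := by
    intro y hy
    have h1 : g ^ (0 : ℤ) < g ^ n y := by
      rw [← hn, zpow_zero]
      exact one_lt_pow' hy (hm y).ne'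
    have h2 : 0 < n y := hmono.lt_iff_lt.mp h1
    have h3 := hm y
    change (0 : ℚ) < n y / m y
    positivity
  have hf : StrictMono f := by
    intro x y hxy
    have := hpos (y / x) (one_lt_div'.mpr hxy)
    rwa [map_div, one_lt_div'] at this
  let H : AddSubgroup ℚ := AddSubgroup.toSubgroup.symm f.range
  refine ⟨H, ⟨{ MulEquiv.ofBijective
      ({ toFun := fun y => Multiplicative.ofAdd (⟨(f y).toAdd, y, rfl⟩ : H)
         map_one' := ?_
         map_mul' := ?_ } : G →* Multiplicative H) ⟨?_, ?_⟩ with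
      map_le_map_iff' := ?_ }⟩⟩
  · simp only [map_one]
    rfl
  · intro x y
    simp only [map_mul]
    rfl
  · intro x y e
    exact hf.injective (congrArg (fun z : Multiplicative H => (z.toAdd : ℚ)) e)
  · rintro ⟨z, y, hy⟩
    exact ⟨y, congrArg Multiplicative.ofAdd (Subtype.ext hy)⟩
  · intro x y
    exact hf.le_iff_le

theorem exists_ne_zero_not_isUnit {A : Type*} [CommRing A] [IsDomain A] (hA : ¬ IsField A) :
    ∃ y : A, y ≠ 0 ∧ ¬ IsUnit y := by
  by_contra! h
  exact hA ⟨exists_pair_ne A, mul_comm, fun hx => (h _ hx).exists_right_inv⟩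

theorem IsAlmostUniformizingParameter.ne_zero {A : Type*} [CommRing A] [IsDomain A]
    (hA : ¬ IsField A) {a : A} (ha : IsAlmostUniformizingParameter a) : a ≠ 0 := by
  rintro rfl
  obtain ⟨y, hy, hyu⟩ := exists_ne_zero_not_isUnit hA
  obtain ⟨m, n, hm, hn, u, e⟩ := ha y hy hyu
  rw [zero_pow hn.ne', mul_zero] at e
  exact hy (eq_zero_of_pow_eq_zero e)

theorem IsAlmostUniformizingParameter.not_isUnit {A : Type*} [CommRing A] [IsDomain A]
    (hA : ¬ IsField A) {a : A} (ha : IsAlmostUniformizingParameter a) : ¬ IsUnit a := by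
  intro hu
  obtain ⟨y, hy, hyu⟩ := exists_ne_zero_not_isUnit hA
  obtain ⟨m, n, hm, hn, u, e⟩ := ha y hy hyu
  exact hyu ((isUnit_pow_iff hm.ne').mp (e ▸ u.isUnit.mul (hu.pow n)))

theorem ValuationRing.valuation_le_iff_dvd {A : Type*} [CommRing A] [IsDomain A] [ValuationRing A]
    (x y : A) : valuation A (FractionRing A) (algebraMap A _ x) ≤
      valuation A (FractionRing A) (algebraMap A _ y) ↔ y ∣ x := by
  constructor
  · rintro ⟨c, hc⟩
    refine ⟨c, IsFractionRing.injective A (FractionRing A) ?_⟩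
    simp only [Algebra.smul_def] at hc
    rw [map_mul, ← hc, mul_comm]
  · rintro ⟨c, rfl⟩
    refine ⟨c, ?_⟩
    simp [Algebra.smul_def, mul_comm]

-- An almost uniformizing parameter says that any value is a rational multiple of one fixed value.
-- This form of the definition can be compared directly with that of RAV-domains.
open scoped Classical in
theorem isRationalValuationDomain_iff {A : Type*} [CommRing A] [IsDomain A] (hA : ¬ IsField A) :
    IsRationalValuationDomain A ↔
      ValuationRing A ∧ ∃ a : A, IsAlmostUniformizingParameter a := by
  constructor
  · rintro ⟨hv, H, ⟨e⟩⟩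
    refine ⟨hv, ?_⟩
    set v := ValuationRing.valuation A (FractionRing A)
    have hv0 : ∀ x : A, x ≠ 0 → v (algebraMap A _ x) ≠ 0 := fun x hx =>
      (Valuation.ne_zero_iff v).mpr (by simpa using hx)
    -- The value of x in ℚ; the default at 0 is never used. In the order of `ValueGroup`, divisors
    -- have larger value, so nonzero nonunits have q x < 0.
    let q : A → ℚ := fun x =>
      if hx : x ≠ 0 then ((e (Units.mk0 _ (hv0 x hx))).toAdd : ℚ) else 0
    have hq : ∀ x (hx : x ≠ 0), q x = ((e (Units.mk0 _ (hv0 x hx))).toAdd : ℚ) :=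
      fun x hx => dif_pos hx
    have hle : ∀ x y, x ≠ 0 → y ≠ 0 → (q x ≤ q y ↔ y ∣ x) := by
      intro x y hx hy
      rw [hq x hx, hq y hy, ← ValuationRing.valuation_le_iff_dvd]
      exact e.map_le_map_iff'
    have hmul : ∀ x y, x ≠ 0 → y ≠ 0 → q (x * y) = q x + q y := by
      intro x y hx hy
      rw [hq _ (mul_ne_zero hx hy), hq x hx, hq y hy, ← AddSubgroup.coe_add, ← toAdd_mul,
        ← map_mul]
      congr 4
      ext
      simp
    have hone : q 1 = 0 := by
      have := hmul 1 1 one_ne_zero one_ne_zero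
      rw [mul_one] at this
      linarith
    have hpow : ∀ x, x ≠ 0 → ∀ n : ℕ, q (x ^ n) = n * q x := by
      intro x hx n
      induction n with
      | zero => simp [hone]
      | succ n ih =>
        rw [pow_succ, hmul _ _ (pow_ne_zero n hx) hx, ih]
        push_cast
        linarith
    have hneg : ∀ x, x ≠ 0 → ¬ IsUnit x → q x < 0 := by
      intro x hx hu
      rw [← hone, ← not_le, hle _ _ one_ne_zero hx]
      exact fun h => hu (isUnit_of_dvd_one h)
    obtain ⟨a, ha, hau⟩ := exists_ne_zero_not_isUnit hA
    refine ⟨a, fun y hy hyu => ?_⟩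
    have h1 := hneg a ha hau
    have h2 := hneg y hy hyu
    -- Clearing the denominator of r gives powers of y and a of equal value, hence associated.
    set r := q y / q a
    have hr : 0 < r := div_pos_of_neg_of_neg h2 h1
    have hrn : 0 < r.num := Rat.num_pos.mpr hr
    obtain ⟨n, hn⟩ := Int.eq_ofNat_of_zero_le hrn.le
    refine ⟨r.den, n, r.den_pos, by omega, ?_⟩
    have hval : q (y ^ r.den) = q (a ^ n) := by
      rw [hpow y hy, hpow a ha]
      have h3 : r * r.den = n := by
        rw [Rat.mul_den_eq_num, hn]
        rfl
      have h4 : q y = r * q a := (div_mul_cancel₀ _ h1.ne).symm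
      rw [h4, ← h3]
      ring
    obtain ⟨u, hu⟩ := associated_of_dvd_dvd
      ((hle _ _ (pow_ne_zero _ hy) (pow_ne_zero _ ha)).mp hval.le)
      ((hle _ _ (pow_ne_zero _ ha) (pow_ne_zero _ hy)).mp hval.ge)
    exact ⟨u, by rw [← hu, mul_comm]⟩
  · rintro ⟨hv, a, ha⟩
    refine ⟨hv, ?_⟩
    set v := ValuationRing.valuation A (FractionRing A)
    have ha0 := ha.ne_zero hA
    have hau := ha.not_isUnit hA
    have hva0 : v (algebraMap A _ a) ≠ 0 := (Valuation.ne_zero_iff v).mpr (by simpa using ha0)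
    -- The inverse appears because the nonunit a has valuation below 1.
    refine exists_orderMonoidIso_multiplicative_addSubgroup_rat (g := (Units.mk0 _ hva0)⁻¹) ?_ ?_
    · rw [one_lt_inv', ← Units.val_lt_val, Units.val_mk0, Units.val_one, ← map_one v,
        ← map_one (algebraMap A (FractionRing A)), ← not_le, ValuationRing.valuation_le_iff_dvd]
      exact fun h => hau (isUnit_of_dvd_one h)
    · intro y hy
      rw [← inv_lt_one'] at hy
      obtain ⟨x, hx⟩ : ∃ x, v x = ((y⁻¹ : (ValuationRing.ValueGroup A (FractionRing A))ˣ) : _) :=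
        Quotient.exists_rep _
      have hx1 : v x < 1 := by
        rw [hx]
        exact hy
      obtain ⟨z, rfl⟩ := (ValuationRing.mem_integer_iff A (FractionRing A) x).mp hx1.le
      have hz0 : z ≠ 0 := by
        rintro rfl
        rw [map_zero, map_zero] at hx
        exact Units.ne_zero _ hx.symm
      have hzu : ¬ IsUnit z := by
        intro hu
        rw [← map_one v, ← map_one (algebraMap A (FractionRing A)), ← not_le,
          ValuationRing.valuation_le_iff_dvd] at hx1
        exact hx1 (isUnit_iff_dvd_one.mp hu)
      obtain ⟨m, n, hm, hn, u, e⟩ := ha z hz0 hzu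
      refine ⟨m, n, hm, hn, ?_⟩
      rw [← inv_inj, ← inv_pow, ← inv_pow, inv_inv]
      ext
      rw [Units.val_pow_eq_pow_val, Units.val_pow_eq_pow_val, ← hx, Units.val_mk0, ← map_pow,
        ← map_pow, ← map_pow, ← map_pow, e]
      refine le_antisymm ?_ ?_ <;> rw [ValuationRing.valuation_le_iff_dvd] <;> simp

/-! ### Divisibility in local domains and in subrings of a field -/

/-- In a local domain, a principal ideal generated by a set is generated by one of its elements. -/
theorem exists_mem_dvd_of_isPrincipal_span {A : Type*} [CommRing A] [IsDomain A] [IsLocalRing A]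
    {S : Set A} (hS : S.Nonempty) (h : (Ideal.span S).IsPrincipal) : ∃ s ∈ S, ∀ t ∈ S, s ∣ t := by
  obtain ⟨c, hc⟩ := h
  have hdvd : ∀ t ∈ S, c ∣ t := fun t ht =>
    Ideal.mem_span_singleton.mp (hc.le (Ideal.subset_span ht))
  by_cases hc0 : c = 0
  · obtain ⟨s, hs⟩ := hS
    refine ⟨s, hs, fun t ht => ?_⟩
    have := hdvd t ht
    rw [hc0, zero_dvd_iff] at this
    exact this ▸ dvd_zero s
  by_contra! hcon
  -- If no s ∈ S divides all of S, every cofactor s / c is a nonunit, so c ∈ c · 𝔪, which is absurd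
  -- for c ≠ 0.
  have hle : Ideal.span S ≤ Ideal.span {c} * IsLocalRing.maximalIdeal A := by
    rw [Ideal.span_le]
    intro s hs
    obtain ⟨x, rfl⟩ := hdvd s hs
    refine Ideal.mul_mem_mul (Ideal.mem_span_singleton_self c) ?_
    intro hx
    obtain ⟨t, ht, hst⟩ := hcon _ hs
    obtain ⟨z, rfl⟩ := hdvd t ht
    exact hst (mul_dvd_mul_left c hx.dvd)
  have hcm : c ∈ Ideal.span {c} * IsLocalRing.maximalIdeal A :=
    hle (hc.ge (Ideal.mem_span_singleton_self c))
  rw [Ideal.mem_span_singleton_mul] at hcm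
  obtain ⟨z, hz, e⟩ := hcm
  have : z = 1 := mul_left_cancel₀ hc0 (by rw [e, mul_one])
  exact hz (this ▸ isUnit_one)

namespace Subring

variable {L : Type*} [Field L] (A : Subring L)

theorem dvd_iff_div_mem {A : Subring L} {a b : A} (ha : a ≠ 0) : a ∣ b ↔ (b / a : L) ∈ A := by
  have ha' : (a : L) ≠ 0 := fun e => ha (Subtype.ext e)
  constructor
  · rintro ⟨c, rfl⟩
    rw [coe_mul, mul_div_cancel_left₀ _ ha']
    exact c.2
  · intro h
    exact ⟨⟨_, h⟩, Subtype.ext (mul_div_cancel₀ _ ha').symm⟩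

theorem isUnit_iff_inv_mem {A : Subring L} {a : A} (ha : a ≠ 0) : IsUnit a ↔ (a : L)⁻¹ ∈ A := by
  rw [isUnit_iff_dvd_one, dvd_iff_div_mem ha, coe_one, one_div]

theorem isField_iff_inv_mem : IsField A ↔ ∀ x ∈ A, x⁻¹ ∈ A := by
  constructor
  · intro h x hx
    by_cases hx0 : x = 0
    · simp [hx0]
    · have h0 : (⟨x, hx⟩ : A) ≠ 0 := fun e => hx0 (congrArg Subtype.val e)
      obtain ⟨y, hy⟩ := h.mul_inv_cancel h0
      exact (isUnit_iff_inv_mem h0).mp (IsUnit.of_mul_eq_one _ hy)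
  · intro h
    refine ⟨exists_pair_ne A, mul_comm, fun {a} ha => ?_⟩
    exact ((isUnit_iff_inv_mem ha).mpr (h a a.2)).exists_right_inv

theorem eq_closure_toSubring_iff_isField :
    A = (Subfield.closure (A : Set L)).toSubring ↔ IsField A := by
  rw [isField_iff_inv_mem]
  constructor
  · intro h x hx
    rw [h] at hx ⊢
    exact (Subfield.closure (A : Set L)).inv_mem hx
  · intro h
    refine le_antisymm (fun x hx => Subfield.subset_closure hx) ?_
    exact (Subfield.closure_le (t := { A with inv_mem' := h })).mpr fun x hx => hx

theorem mem_closure_iff_exists_div (x : L) :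
    x ∈ Subfield.closure (A : Set L) ↔ ∃ a ∈ A, ∃ b ∈ A, a / b = x := by
  rw [Subfield.mem_closure_iff, Subring.closure_eq]

theorem isAVDomain_iff : IsAVDomain A ↔
    ∀ a ∈ A, ∀ b ∈ A, a ≠ 0 → b ≠ 0 → ∃ n : ℕ, 0 < n ∧ ((b / a) ^ n ∈ A ∨ (b / a)⁻¹ ^ n ∈ A) := by
  have key : ∀ (a b : A) (n : ℕ), a ≠ 0 → b ≠ 0 → ((a ^ n ∣ b ^ n ∨ b ^ n ∣ a ^ n) ↔
      ((b / a : L) ^ n ∈ A ∨ (b / a : L)⁻¹ ^ n ∈ A)) := by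
    intro a b n ha hb
    rw [dvd_iff_div_mem (pow_ne_zero n ha), dvd_iff_div_mem (pow_ne_zero n hb), inv_div,
      coe_pow, coe_pow, div_pow, div_pow]
  constructor
  · intro h a ha b hb ha0 hb0
    have h1 : (⟨a, ha⟩ : A) ≠ 0 := fun e => ha0 (congrArg Subtype.val e)
    have h2 : (⟨b, hb⟩ : A) ≠ 0 := fun e => hb0 (congrArg Subtype.val e)
    obtain ⟨n, hn, h3⟩ := h _ _ h1 h2
    exact ⟨n, hn, (key _ _ n h1 h2).mp h3⟩
  · intro h a b ha hb
    obtain ⟨n, hn, h3⟩ := h a a.2 b b.2 (fun e => ha (Subtype.ext e)) (fun e => hb (Subtype.ext e))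
    exact ⟨n, hn, (key _ _ n ha hb).mpr h3⟩

theorem valuationRing_iff_of_isFractionRing [IsFractionRing A L] :
    ValuationRing A ↔ ∀ x : L, x ∈ A ∨ x⁻¹ ∈ A := by
  rw [ValuationRing.iff_isInteger_or_isInteger A L]
  have : ∀ x : L, IsLocalization.IsInteger A x ↔ x ∈ A := fun x =>
    ⟨fun ⟨y, hy⟩ => hy ▸ y.2, fun hx => ⟨⟨x, hx⟩, rfl⟩⟩
  simp only [this]

theorem isFractionRing_of_forall_mem_or_inv_mem (h : ∀ x : L, x ∈ A ∨ x⁻¹ ∈ A) :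
    IsFractionRing A L :=
  isFractionRing_of_exists_eq_algebraMap_or_inv_eq_algebraMap_of_injective
    (fun x => (h x).elim (fun hx => ⟨⟨x, hx⟩, .inl rfl⟩) fun hx => ⟨⟨_, hx⟩, .inr rfl⟩)
    Subtype.val_injective

theorem valuationRing_and_isFractionRing_iff :
    ValuationRing A ∧ IsFractionRing A L ↔ ∀ x : L, x ∈ A ∨ x⁻¹ ∈ A := by
  constructor
  · rintro ⟨h, h'⟩
    exact (valuationRing_iff_of_isFractionRing A).mp h
  · intro h
    have := isFractionRing_of_forall_mem_or_inv_mem A h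
    exact ⟨(valuationRing_iff_of_isFractionRing A).mpr h, this⟩

theorem valuationRing_and_closure_eq_top_iff :
    ValuationRing A ∧ Subfield.closure (A : Set L) = ⊤ ↔ ∀ x : L, x ∈ A ∨ x⁻¹ ∈ A := by
  constructor
  · rintro ⟨h, htop⟩ x
    obtain ⟨a, ha, b, hb, rfl⟩ := (mem_closure_iff_exists_div A x).mp (htop ▸ Subfield.mem_top x)
    by_cases ha0 : a = 0
    · simp [ha0, A.zero_mem]
    by_cases hb0 : b = 0
    · simp [hb0, A.zero_mem]
    have h1 : (⟨a, ha⟩ : A) ≠ 0 := fun e => ha0 (congrArg Subtype.val e)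
    have h2 : (⟨b, hb⟩ : A) ≠ 0 := fun e => hb0 (congrArg Subtype.val e)
    rcases ValuationRing.dvd_total (⟨a, ha⟩ : A) ⟨b, hb⟩ with h | h
    · exact .inr (by rw [inv_div]; exact (dvd_iff_div_mem h1).mp h)
    · exact .inl ((dvd_iff_div_mem h2).mp h)
  · intro h
    refine ⟨((valuationRing_and_isFractionRing_iff A).mpr h).1, eq_top_iff.mpr fun x _ => ?_⟩
    rcases h x with hx | hx
    · exact Subfield.subset_closure hx
    · simpa using Subfield.inv_mem _ (Subfield.subset_closure hx)

end Subring

/-! ### D + M as a pullback, and its transfer properties -/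

/-- `R` is the preimage of the subring `D` of `K` under a surjection `π` of the nontrivial valuation
ring `V` onto a coefficient field `K ⊆ V`. -/
structure IsCoefficientPullback {K L : Type*} [Field K] [Field L] [Algebra K L]
    (V : ValuationSubring L) (π : V →+* K) (D : Subring K) (R : Subring L) : Prop where
  not_isField : ¬ IsField V
  algebraMap_mem : ∀ k : K, algebraMap K L k ∈ V
  apply_algebraMap : ∀ k : K, π ⟨algebraMap K L k, algebraMap_mem k⟩ = k
  apply_eq_zero_iff : ∀ x : V, π x = 0 ↔ V.valuation (x : L) < 1
  mem_iff : ∀ x : L, x ∈ R ↔ ∃ h : x ∈ V, π ⟨x, h⟩ ∈ D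

/-- π is the residue map followed by the inverse of K ≅ V/M. One π serves all D at once, which
allows R and its integral closure to be compared. -/
theorem exists_ringHom_isCoefficientPullback {K L : Type*} [Field K] [Field L] [Algebra K L]
    (V : ValuationSubring L) (hV : ¬ IsField V) (hKV : ∀ k : K, algebraMap K L k ∈ V)
    (hsum : plusMaxIdeal V hKV (⊤ : Subring K) = V.toSubring) :
    ∃ π : V →+* K, ∀ D : Subring K, IsCoefficientPullback V π D (plusMaxIdeal V hKV D) := by
  let ι : K →+* IsLocalRing.ResidueField V :=
    (IsLocalRing.residue V).comp ((algebraMap K L).codRestrict V.toSubring hKV)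
  have hι : ∀ k, ι k = IsLocalRing.residue V ⟨algebraMap K L k, hKV k⟩ := fun _ => rfl
  have hbij : Function.Bijective ι := by
    refine ⟨ι.injective, fun y => ?_⟩
    obtain ⟨x, rfl⟩ := IsLocalRing.residue_surjective y
    have hx : (x : L) ∈ plusMaxIdeal V hKV (⊤ : Subring K) := hsum ▸ x.2
    obtain ⟨a, -, m, hm, e⟩ := hx
    refine ⟨a, ?_⟩
    have : x = ⟨algebraMap K L a, hKV a⟩ + m := Subtype.ext e
    rw [this, map_add, (IsLocalRing.residue_eq_zero_iff m).mpr hm, add_zero, hι]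
  let e := RingEquiv.ofBijective ι hbij
  let π : V →+* K := e.symm.toRingHom.comp (IsLocalRing.residue V)
  have h1 : ∀ k, π ⟨algebraMap K L k, hKV k⟩ = k := fun k => e.symm_apply_apply k
  have h2 : ∀ x : V, π x = 0 ↔ V.valuation (x : L) < 1 := by
    intro x
    rw [← ValuationSubring.valuation_lt_one_iff, ← IsLocalRing.residue_eq_zero_iff]
    exact e.symm.map_eq_zero_iff
  refine ⟨π, fun D => ⟨hV, hKV, h1, h2, fun x => ⟨?_, ?_⟩⟩⟩
  · rintro ⟨a, ha, m, hm, rfl⟩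
    refine ⟨add_mem (hKV a) m.2, ?_⟩
    have : π (⟨algebraMap K L a, hKV a⟩ + m) = a := by
      rw [map_add, h1, (h2 m).mpr ((ValuationSubring.valuation_lt_one_iff V m).mp hm), add_zero]
    have h3 : π ⟨algebraMap K L a + m, add_mem (hKV a) m.2⟩ = a := this
    rwa [h3]
  · rintro ⟨h, hx⟩
    refine ⟨_, hx, ⟨x, h⟩ - ⟨_, hKV (π ⟨x, h⟩)⟩, ?_, by push_cast; ring⟩
    rw [ValuationSubring.valuation_lt_one_iff, ← h2, map_sub, h1, sub_self]

namespace IsCoefficientPullback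

variable {K L : Type*} [Field K] [Field L] [Algebra K L] {V : ValuationSubring L} {π : V →+* K}
  {D : Subring K} {R : Subring L} (h : IsCoefficientPullback V π D R)
include h

theorem le : R ≤ V.toSubring := fun x hx => ((h.mem_iff x).mp hx).1

theorem coe_mem_iff (x : V) : (x : L) ∈ R ↔ π x ∈ D :=
  (h.mem_iff x).trans ⟨fun ⟨_, hx⟩ => hx, fun hx => ⟨x.2, hx⟩⟩

theorem pow_mem_iff {x : L} (hx : x ∈ V) (n : ℕ) : x ^ n ∈ R ↔ π ⟨x, hx⟩ ^ n ∈ D := by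
  rw [← map_pow, ← h.coe_mem_iff]
  rfl

theorem algebraMap_mem_iff (k : K) : algebraMap K L k ∈ R ↔ k ∈ D := by
  have := h.coe_mem_iff ⟨_, h.algebraMap_mem k⟩
  rwa [h.apply_algebraMap] at this

theorem mem_of_valuation_lt {x : L} (hx : V.valuation x < 1) : x ∈ R := by
  have hxV : x ∈ V := (V.valuation_le_one_iff x).mp hx.le
  rw [h.coe_mem_iff ⟨x, hxV⟩, (h.apply_eq_zero_iff _).mpr hx]
  exact D.zero_mem

theorem valuation_algebraMap {k : K} (hk : k ≠ 0) : V.valuation (algebraMap K L k) = 1 := by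
  refine le_antisymm ((V.valuation_le_one_iff _).mpr (h.algebraMap_mem k)) (not_lt.mp fun hlt => ?_)
  have := (h.apply_eq_zero_iff ⟨_, h.algebraMap_mem k⟩).mpr hlt
  exact hk (by rwa [h.apply_algebraMap] at this)

theorem exists_valuation_lt_one : ∃ m : L, m ≠ 0 ∧ V.valuation m < 1 := by
  obtain ⟨y, hy, hu⟩ := exists_ne_zero_not_isUnit h.not_isField
  exact ⟨y, fun e => hy (Subtype.ext e), (V.valuation_lt_one_iff y).mp hu⟩

theorem valuation_sub_lt_one {x : L} (hx : x ∈ V) :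
    V.valuation (x - algebraMap K L (π ⟨x, hx⟩)) < 1 := by
  have := (h.apply_eq_zero_iff (⟨x, hx⟩ - ⟨_, h.algebraMap_mem (π ⟨x, hx⟩)⟩)).mp
    (by rw [map_sub, h.apply_algebraMap, sub_self])
  exact this

omit h in
theorem valuation_mul_lt_one {x y : L} (hx : V.valuation x < 1) (hy : y ∈ V) :
    V.valuation (x * y) < 1 := by
  rw [map_mul]
  exact mul_lt_one_of_lt_of_le hx ((V.valuation_le_one_iff y).mpr hy)

/-- For z ∈ V write z = (m z) / m; otherwise z = m / (m z⁻¹). Numerators and denominators lie in M ⊆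
R. -/
theorem isFractionRing : IsFractionRing R L := by
  refine IsFractionRing.of_field R L fun z => ?_
  obtain ⟨m, hm0, hm⟩ := h.exists_valuation_lt_one
  rcases V.mem_or_inv_mem z with hz | hz
  · exact ⟨⟨_, h.mem_of_valuation_lt (valuation_mul_lt_one hm hz)⟩,
      ⟨m, h.mem_of_valuation_lt hm⟩, (mul_div_cancel_left₀ z hm0).symm⟩
  · by_cases hz0 : z = 0
    · exact ⟨0, 1, by simp [hz0]⟩
    refine ⟨⟨m, h.mem_of_valuation_lt hm⟩,
      ⟨_, h.mem_of_valuation_lt (valuation_mul_lt_one hm hz)⟩, ?_⟩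
    change z = m / (m * z⁻¹)
    field_simp

theorem eq_valuationSubring_iff : R = V.toSubring ↔ D = ⊤ := by
  constructor
  · intro e
    refine eq_top_iff.mpr fun k _ => ?_
    rw [← h.algebraMap_mem_iff, e]
    exact h.algebraMap_mem k
  · rintro rfl
    exact le_antisymm h.le fun x hx => (h.mem_iff x).mpr ⟨hx, Subring.mem_top _⟩

theorem conductorSet_eq (hlt : R < V.toSubring) :
    conductorSet R V.toSubring = Subtype.val '' (IsLocalRing.maximalIdeal V : Set V) := by
  ext x
  constructor
  · intro hx
    have hxR : x ∈ R := by simpa using hx 1 (one_mem _)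
    have hxV : x ∈ V := h.le hxR
    refine ⟨⟨x, hxV⟩, ?_, rfl⟩
    rw [SetLike.mem_coe, V.valuation_lt_one_iff, ← h.apply_eq_zero_iff]
    by_contra hne
    refine hlt.ne (h.eq_valuationSubring_iff.mpr (eq_top_iff.mpr fun k _ => ?_))
    set d := π ⟨x, hxV⟩
    -- If x has residue d ≠ 0, its multiple by d⁻¹ k has residue k, which puts every k ∈ K in D.
    have h1 := hx (algebraMap K L (d⁻¹ * k)) (h.algebraMap_mem _)
    have h2 := (h.coe_mem_iff (⟨x, hxV⟩ * ⟨_, h.algebraMap_mem (d⁻¹ * k)⟩)).mp h1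
    rwa [map_mul, h.apply_algebraMap, mul_inv_cancel_left₀ hne] at h2
  · rintro ⟨y, hy, rfl⟩ b hb
    rw [SetLike.mem_coe, V.valuation_lt_one_iff] at hy
    exact h.mem_of_valuation_lt (valuation_mul_lt_one hy hb)

/-- The restriction of π to R. It is local because an x ∈ R of nonzero residue is a unit of V, and
the residue of x⁻¹ is the inverse of that of x. -/
theorem exists_ringHom : ∃ ρ : R →+* D, Function.Surjective ρ ∧ IsLocalHom ρ ∧
    (∀ x : R, ρ x = 0 ↔ V.valuation (x : L) < 1) ∧
    ∀ x : R, (ρ x : K) = π ⟨x, h.le x.2⟩ := by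
  let ρ : R →+* D := (π.comp (Subring.inclusion h.le)).codRestrict D fun x =>
    (h.coe_mem_iff ⟨x, h.le x.2⟩).mp x.2
  have hρ : ∀ x : R, (ρ x : K) = π ⟨x, h.le x.2⟩ := fun _ => rfl
  have h0 : ∀ x : R, ρ x = 0 ↔ V.valuation (x : L) < 1 := by
    intro x
    rw [← h.apply_eq_zero_iff ⟨x, h.le x.2⟩, ← hρ]
    exact Subtype.ext_iff
  refine ⟨ρ, fun d => ⟨⟨_, (h.algebraMap_mem_iff d).mpr d.2⟩, Subtype.ext ?_⟩, ⟨fun x hx => ?_⟩,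
    h0, hρ⟩
  · rw [hρ]
    exact h.apply_algebraMap d
  · have hv : V.valuation (x : L) = 1 := by
      refine le_antisymm ((V.valuation_le_one_iff _).mpr (h.le x.2)) (not_lt.mp fun hlt => ?_)
      exact hx.ne_zero ((h0 x).mpr hlt)
    have hx0 : (x : L) ≠ 0 := fun e => by simp [e] at hv
    have hinv : (x : L)⁻¹ ∈ V := (V.valuation_le_one_iff _).mp (by rw [map_inv₀, hv, inv_one])
    rw [Subring.isUnit_iff_inv_mem (fun e => hx0 (congrArg Subtype.val e)),
      h.coe_mem_iff ⟨_, hinv⟩]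
    have h1 : π ⟨x, h.le x.2⟩ * π ⟨_, hinv⟩ = 1 := by
      rw [← map_mul, ← map_one π]
      exact congrArg π (Subtype.ext (mul_inv_cancel₀ hx0))
    rw [Subring.isUnit_iff_inv_mem hx.ne_zero, hρ, inv_eq_of_mul_eq_one_right h1] at hx
    exact hx

theorem isLocalRing_iff : IsLocalRing R ↔ IsLocalRing D := by
  obtain ⟨ρ, hs, hl, -⟩ := h.exists_ringHom
  exact ⟨fun _ => IsLocalRing.of_surjective' ρ hs, fun _ => RingHom.domain_isLocalRing ρ⟩

/-- V is integrally closed, so x ∈ V, and π carries an integral equation over R to one over D.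
Conversely x differs from its residue by an element of M ⊆ R. -/
theorem mem_integralClosure_iff_apply_mem (x : L) :
    x ∈ integralClosure R L ↔ ∃ hx : x ∈ V, π ⟨x, hx⟩ ∈ integralClosure D K := by
  obtain ⟨ρ, -, -, -, hρ⟩ := h.exists_ringHom
  simp only [mem_integralClosure_iff]
  constructor
  · intro hx
    have hxV : x ∈ V := by
      have h1 : IsIntegral V x := hx.map_of_comp_eq (Subring.inclusion h.le) (RingHom.id L) rfl
      obtain ⟨y, rfl⟩ := IsIntegrallyClosed.isIntegral_iff.mp h1
      exact y.2
    refine ⟨hxV, ?_⟩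
    let : Algebra R V := (Subring.inclusion h.le).toAlgebra
    have h2 : IsIntegral R (⟨x, hxV⟩ : V) := by
      obtain ⟨p, hp, e⟩ := hx
      refine ⟨p, hp, Subtype.val_injective ?_⟩
      change V.subtype _ = _
      rw [Polynomial.hom_eval₂]
      exact e
    exact h2.map_of_comp_eq ρ π (RingHom.ext hρ)
  · rintro ⟨hxV, hx⟩
    let φ : D →+* R := ((algebraMap K L).comp D.subtype).codRestrict R fun d =>
      (h.algebraMap_mem_iff d).mpr d.2
    have h1 : IsIntegral R (algebraMap K L (π ⟨x, hxV⟩)) :=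
      hx.map_of_comp_eq φ (algebraMap K L) rfl
    have h2 : IsIntegral R (x - algebraMap K L (π ⟨x, hxV⟩)) :=
      isIntegral_algebraMap (x := (⟨_, h.mem_of_valuation_lt (h.valuation_sub_lt_one hxV)⟩ : R))
    simpa using h1.add h2

theorem pullback_integralClosure : IsCoefficientPullback V π (integralClosure D K).toSubring
    (integralClosure R L).toSubring :=
  ⟨h.not_isField, h.algebraMap_mem, h.apply_algebraMap, h.apply_eq_zero_iff,
    h.mem_integralClosure_iff_apply_mem⟩

/-- Only x of valuation 1 needs the hypothesis on D; there π x⁻¹ is the inverse of π x. -/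
theorem forall_mem_or_inv_mem_iff :
    (∀ x : L, x ∈ R ∨ x⁻¹ ∈ R) ↔ ∀ k : K, k ∈ D ∨ k⁻¹ ∈ D := by
  constructor
  · intro H k
    rw [← h.algebraMap_mem_iff k, ← h.algebraMap_mem_iff k⁻¹, map_inv₀]
    exact H _
  · intro H x
    rcases lt_trichotomy (V.valuation x) 1 with hx | hx | hx
    · exact .inl (h.mem_of_valuation_lt hx)
    · have hxV : x ∈ V := (V.valuation_le_one_iff x).mp hx.le
      have hiV : x⁻¹ ∈ V := (V.valuation_le_one_iff _).mp (by rw [map_inv₀, hx, inv_one])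
      have hx0 : x ≠ 0 := fun e => by simp [e] at hx
      have h1 : π ⟨x, hxV⟩ * π ⟨_, hiV⟩ = 1 := by
        rw [← map_mul, ← map_one π]
        exact congrArg π (Subtype.ext (mul_inv_cancel₀ hx0))
      have := H (π ⟨x, hxV⟩)
      rwa [inv_eq_of_mul_eq_one_right h1, ← h.coe_mem_iff, ← h.coe_mem_iff] at this
    · refine .inr (h.mem_of_valuation_lt ?_)
      rw [map_inv₀]
      exact inv_lt_one_of_one_lt₀ hx

theorem valuationRing_iff :
    ValuationRing R ↔ ValuationRing D ∧ Subfield.closure (D : Set K) = ⊤ := by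
  have := h.isFractionRing
  rw [Subring.valuationRing_iff_of_isFractionRing, h.forall_mem_or_inv_mem_iff,
    Subring.valuationRing_and_closure_eq_top_iff]

theorem forall_pow_mem_iff {A : Subring K} {B : Subring L} (h' : IsCoefficientPullback V π A B)
    {n : ℕ} : (∀ b ∈ B, b ^ n ∈ R) ↔ ∀ a ∈ A, a ^ n ∈ D := by
  constructor
  · intro H a ha
    have := H _ ((h'.algebraMap_mem_iff a).mpr ha)
    rwa [← map_pow, h.algebraMap_mem_iff] at this
  · intro H b hb
    rw [h.pow_mem_iff (h'.le hb)]
    exact H _ ((h'.coe_mem_iff ⟨b, h'.le hb⟩).mp hb)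

theorem forall_exists_pow_mem_iff {A : Subring K} {B : Subring L}
    (h' : IsCoefficientPullback V π A B) :
    (∀ b ∈ B, ∃ n : ℕ, 0 < n ∧ b ^ n ∈ R) ↔ ∀ a ∈ A, ∃ n : ℕ, 0 < n ∧ a ^ n ∈ D := by
  constructor
  · intro H a ha
    obtain ⟨n, hn, hr⟩ := H _ ((h'.algebraMap_mem_iff a).mpr ha)
    rw [← map_pow, h.algebraMap_mem_iff] at hr
    exact ⟨n, hn, hr⟩
  · intro H b hb
    obtain ⟨n, hn, hr⟩ := H _ ((h'.coe_mem_iff ⟨b, h'.le hb⟩).mp hb)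
    exact ⟨n, hn, (h.pow_mem_iff (h'.le hb) n).mpr hr⟩

end IsCoefficientPullback

/-! ### Root extensions and almost valuation conditions for subrings of a field -/

theorem isRootExtension_integralClosure_iff {L : Type*} [Field L] (A : Subring L) :
    IsRootExtension A (integralClosure A L) ↔
      ∀ b ∈ (integralClosure A L).toSubring, ∃ n : ℕ, 0 < n ∧ b ^ n ∈ A := by
  constructor
  · intro h b hb
    obtain ⟨n, hn, c, hc⟩ := h ⟨b, hb⟩
    have : (c : L) = b ^ n := congrArg Subtype.val hc
    exact ⟨n, hn, this ▸ c.2⟩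
  · rintro h ⟨b, hb⟩
    obtain ⟨n, hn, hc⟩ := h b hb
    exact ⟨n, hn, ⟨_, hc⟩, Subtype.ext rfl⟩

theorem isBoundedRootExtension_integralClosure_iff {L : Type*} [Field L] (A : Subring L) :
    IsBoundedRootExtension A (integralClosure A L) ↔
      ∃ n : ℕ, 0 < n ∧ ∀ b ∈ (integralClosure A L).toSubring, b ^ n ∈ A := by
  refine exists_congr fun n => and_congr_right fun _ => ⟨fun h b hb => ?_, fun h b => ?_⟩
  · obtain ⟨c, hc⟩ := h ⟨b, hb⟩
    have : (c : L) = b ^ n := congrArg Subtype.val hc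
    exact this ▸ c.2
  · exact ⟨⟨_, h b b.2⟩, Subtype.ext rfl⟩

theorem isRootExtension_subfield_iff {K : Type*} [Field K] (F : Subfield K) :
    IsRootExtension F K ↔ ∀ k : K, ∃ n : ℕ, 0 < n ∧ k ^ n ∈ F :=
  forall_congr' fun _ => exists_congr fun _ => and_congr_right fun _ =>
    ⟨fun ⟨c, hc⟩ => hc ▸ c.2, fun hk => ⟨⟨_, hk⟩, rfl⟩⟩

theorem isBoundedRootExtension_subfield_iff {K : Type*} [Field K] (F : Subfield K) :
    IsBoundedRootExtension F K ↔ ∃ n : ℕ, 0 < n ∧ ∀ k : K, k ^ n ∈ F :=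
  exists_congr fun _ => and_congr_right fun _ => forall_congr' fun _ =>
    ⟨fun ⟨c, hc⟩ => hc ▸ c.2, fun hk => ⟨⟨_, hk⟩, rfl⟩⟩

theorem Subring.forall_pow_mem_or_inv_pow_mem_iff_integralClosure {K : Type*} [Field K]
    (D : Subring K) :
    (∀ k : K, k ≠ 0 → ∃ n : ℕ, 0 < n ∧ (k ^ n ∈ D ∨ k⁻¹ ^ n ∈ D)) ↔
      (∀ k : K, k ∈ (integralClosure D K).toSubring ∨ k⁻¹ ∈ (integralClosure D K).toSubring) ∧
        ∀ k ∈ (integralClosure D K).toSubring, ∃ n : ℕ, 0 < n ∧ k ^ n ∈ D := by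
  have key : ∀ (k : K) (n : ℕ), 0 < n → k ^ n ∈ D → k ∈ (integralClosure D K).toSubring := by
    intro k n hn hk
    exact IsIntegral.of_pow hn (isIntegral_algebraMap (x := (⟨_, hk⟩ : D)))
  constructor
  · intro h
    refine ⟨fun k => ?_, fun k hk => ?_⟩
    · by_cases hk : k = 0
      · exact .inl (hk ▸ zero_mem _)
      obtain ⟨n, hn, h⟩ := h k hk
      exact h.imp (key _ n hn) (key _ n hn)
    · by_cases hk0 : k = 0
      · exact ⟨1, one_pos, by simp [hk0]⟩
      obtain ⟨n, hn, h | h⟩ := h k hk0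
      · exact ⟨n, hn, h⟩
      · refine ⟨n, hn, ?_⟩
        have h1 : (⟨_, h⟩ : D) ≠ 0 := fun e =>
          pow_ne_zero n (inv_ne_zero hk0) (congrArg Subtype.val e)
        -- k⁻¹ ^ n ∈ D is invertible in the integral closure, and an integral extension creates no
        -- new units of D; thus k ^ n ∈ D.
        have h2 : IsUnit (algebraMap D (integralClosure D K) ⟨_, h⟩) := by
          refine IsUnit.of_mul_eq_one (⟨k, hk⟩ ^ n) (Subtype.ext ?_)
          change k⁻¹ ^ n * k ^ n = 1
          rw [← mul_pow, inv_mul_cancel₀ hk0, one_pow]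
        have h3 := (Subring.isUnit_iff_inv_mem h1).mp (isUnit_of_map_unit _ _ h2)
        simpa using h3
  · rintro ⟨h1, h2⟩ k hk
    rcases h1 k with h | h
    · obtain ⟨n, hn, h⟩ := h2 _ h
      exact ⟨n, hn, .inl h⟩
    · obtain ⟨n, hn, h⟩ := h2 _ h
      exact ⟨n, hn, .inr h⟩

theorem Subring.forall_pow_mem_or_inv_pow_mem_iff_isAVDomain {K : Type*} [Field K]
    (D : Subring K) :
    (∀ k : K, k ≠ 0 → ∃ n : ℕ, 0 < n ∧ (k ^ n ∈ D ∨ k⁻¹ ^ n ∈ D)) ↔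
      IsAVDomain D ∧ ∀ k : K, ∃ n : ℕ, 0 < n ∧ k ^ n ∈ Subfield.closure (D : Set K) := by
  rw [Subring.isAVDomain_iff]
  constructor
  · intro h
    refine ⟨fun a _ b _ ha hb => h _ (div_ne_zero hb ha), fun k => ?_⟩
    by_cases hk0 : k = 0
    · exact ⟨1, one_pos, by simp [hk0]⟩
    obtain ⟨n, hn, h | h⟩ := h k hk0
    · exact ⟨n, hn, Subfield.subset_closure h⟩
    · refine ⟨n, hn, ?_⟩
      simpa using Subfield.inv_mem _ (Subfield.subset_closure h)
  · rintro ⟨h1, h2⟩ k hk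
    obtain ⟨n, hn, h⟩ := h2 k
    -- k ^ n = b / a with a, b ∈ D, to which the AV property of D applies.
    obtain ⟨b, hb, a, ha, e⟩ := (Subring.mem_closure_iff_exists_div D _).mp h
    have hne := e ▸ pow_ne_zero n hk
    obtain ⟨m, hm, h⟩ := h1 a ha b hb (fun e => hne (by simp [e])) (fun e => hne (by simp [e]))
    refine ⟨n * m, Nat.mul_pos hn hm, ?_⟩
    rwa [pow_mul, pow_mul, inv_pow, ← e]

theorem IsDiscreteValuationRing.exists_maximalIdeal_pow_le {A : Type*} [CommRing A] [IsDomain A]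
    [IsDiscreteValuationRing A] {x : A} (hx : x ≠ 0) :
    ∃ n : ℕ, IsLocalRing.maximalIdeal A ^ n ≤ Ideal.span {x} := by
  obtain ⟨ϖ, hϖ⟩ := exists_irreducible A
  obtain ⟨n, hn⟩ := associated_pow_irreducible hx hϖ
  refine ⟨n, ?_⟩
  rw [hϖ.maximalIdeal_eq, Ideal.span_singleton_pow, Ideal.span_singleton_le_span_singleton]
  exact hn.dvd

/-! ### AV- and RAV-criteria for the pullback -/

namespace IsCoefficientPullback

variable {K L : Type*} [Field K] [Field L] [Algebra K L] {V : ValuationSubring L} {π : V →+* K}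
  {D : Subring K} {R : Subring L} (h : IsCoefficientPullback V π D R)
include h

theorem not_isUnit_of_valuation_lt {x : R} (hx : V.valuation (x : L) < 1) : ¬ IsUnit x := by
  intro hu
  have := hu.map (Subring.inclusion h.le)
  exact hx.ne ((V.valuation_eq_one_iff _).mp this)

theorem valuation_lt_of_not_isUnit (hD : IsField D) {x : R} (hx : ¬ IsUnit x) :
    V.valuation (x : L) < 1 := by
  obtain ⟨ρ, -, hl, h0, -⟩ := h.exists_ringHom
  rw [← h0]
  by_contra hne
  obtain ⟨y, hy⟩ := hD.mul_inv_cancel hne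
  exact hx (isUnit_of_map_unit ρ x (IsUnit.of_mul_eq_one y hy))

theorem not_isField_pullback : ¬ IsField R := by
  obtain ⟨m, hm0, hm⟩ := h.exists_valuation_lt_one
  intro hR
  have hm0' : (⟨m, h.mem_of_valuation_lt hm⟩ : R) ≠ 0 := fun e => hm0 (congrArg Subtype.val e)
  obtain ⟨y, hy⟩ := hR.mul_inv_cancel hm0'
  exact h.not_isUnit_of_valuation_lt hm (IsUnit.of_mul_eq_one y hy)

theorem valuation_mul_algebraMap {k : K} (hk : k ≠ 0) (x : L) :
    V.valuation (x * algebraMap K L k) = V.valuation x := by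
  rw [map_mul, h.valuation_algebraMap hk, mul_one]

/-- The test pair m, m k has quotient k. Conversely, a quotient of valuation 1 is governed by its
residue, and for any other the exponent 1 suffices. -/
theorem isAVDomain_iff : IsAVDomain R ↔
    ∀ k : K, k ≠ 0 → ∃ n : ℕ, 0 < n ∧ (k ^ n ∈ D ∨ k⁻¹ ^ n ∈ D) := by
  rw [Subring.isAVDomain_iff]
  constructor
  · intro H k hk
    obtain ⟨m, hm0, hm⟩ := h.exists_valuation_lt_one
    obtain ⟨n, hn, H⟩ := H m (h.mem_of_valuation_lt hm) (m * algebraMap K L k)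
      (h.mem_of_valuation_lt (by rwa [h.valuation_mul_algebraMap hk])) hm0
      (mul_ne_zero hm0 (by simpa using hk))
    rw [mul_div_cancel_left₀ _ hm0, ← map_inv₀, ← map_pow, ← map_pow, h.algebraMap_mem_iff,
      h.algebraMap_mem_iff] at H
    exact ⟨n, hn, H⟩
  · intro H a _ b _ ha hb
    have hx0 := div_ne_zero hb ha
    set x := b / a
    rcases lt_trichotomy (V.valuation x) 1 with hx | hx | hx
    · exact ⟨1, one_pos, .inl (by rw [pow_one]; exact h.mem_of_valuation_lt hx)⟩
    · have hxV : x ∈ V := (V.valuation_le_one_iff x).mp hx.le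
      have hiV : x⁻¹ ∈ V := (V.valuation_le_one_iff _).mp (by rw [map_inv₀, hx, inv_one])
      have h1 : π ⟨x, hxV⟩ * π ⟨_, hiV⟩ = 1 := by
        rw [← map_mul, ← map_one π]
        exact congrArg π (Subtype.ext (mul_inv_cancel₀ hx0))
      obtain ⟨n, hn, H⟩ := H _ (left_ne_zero_of_mul_eq_one h1)
      rw [inv_eq_of_mul_eq_one_right h1, ← h.pow_mem_iff, ← h.pow_mem_iff] at H
      exact ⟨n, hn, H⟩
    · refine ⟨1, one_pos, .inr ?_⟩
      rw [pow_one]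
      refine h.mem_of_valuation_lt ?_
      rw [map_inv₀]
      exact inv_lt_one_of_one_lt₀ hx

/-- In a RAV-domain any two nonzero nonunits have associated powers. A nonunit of D has valuation 1
and m has smaller valuation, so D is a field; for m k and m equal valuations force equal exponents,
which leaves k ^ i ∈ R. Conversely, a power of the unit u of V lies in R. -/
theorem isRAVDomain_iff : IsRAVDomain R ↔
    IsRationalValuationDomain V ∧ IsField D ∧ ∀ k : K, ∃ n : ℕ, 0 < n ∧ k ^ n ∈ D := by
  rw [isRationalValuationDomain_iff h.not_isField]
  obtain ⟨m, hm0, hm⟩ := h.exists_valuation_lt_one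
  constructor
  · rintro ⟨hR, a, ha⟩
    have hcomp : ∀ x y : R, x ≠ 0 → ¬ IsUnit x → y ≠ 0 → ¬ IsUnit y →
        ∃ i j : ℕ, 0 < i ∧ 0 < j ∧ ∃ u : Rˣ, x ^ i = u * y ^ j := by
      intro x y hx hxu hy hyu
      obtain ⟨i, j, hi, hj, u, e⟩ := ha x hx hxu
      obtain ⟨i', j', hi', hj', u', e'⟩ := ha y hy hyu
      -- These exponents make both sides unit multiples of a ^ (j * j').
      refine ⟨i * j', i' * j, Nat.mul_pos hi hj', Nat.mul_pos hi' hj, u ^ j' * (u' ^ j)⁻¹, ?_⟩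
      rw [pow_mul, pow_mul, e, e', mul_pow, mul_pow, ← pow_mul, ← pow_mul, mul_comm j j',
        Units.val_mul, Units.val_pow_eq_pow_val]
      calc _ = (u : R) ^ j' * (((u' ^ j)⁻¹ * u' ^ j : Rˣ) : R) * a ^ (j' * j) := by simp
        _ = _ := by rw [Units.val_mul, Units.val_pow_eq_pow_val]; ring
    have hval : ∀ (x y : R) (u : Rˣ) (i j : ℕ), x ^ i = u * y ^ j →
        V.valuation (x : L) ^ i = V.valuation (y : L) ^ j := by
      intro x y u i j e
      have h1 : V.valuation ((u : R) : L) = 1 :=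
        (V.valuation_eq_one_iff _).mp (u.isUnit.map (Subring.inclusion h.le))
      rw [← map_pow, ← map_pow, ← Subring.coe_pow, e, Subring.coe_mul, map_mul, h1, one_mul,
        Subring.coe_pow]
    have hmR := h.mem_of_valuation_lt hm
    have hm0' : (⟨m, hmR⟩ : R) ≠ 0 := fun e => hm0 (congrArg Subtype.val e)
    have hvm : V.valuation m ≠ 0 := (Valuation.ne_zero_iff _).mpr hm0
    have hD : IsField D := by
      by_contra hD
      obtain ⟨d, hd, hdu⟩ := exists_ne_zero_not_isUnit hD
      have hd' : (d : K) ≠ 0 := fun e => hd (Subtype.ext e)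
      have hdR := (h.algebraMap_mem_iff d).mpr d.2
      have hd0 : (⟨_, hdR⟩ : R) ≠ 0 := fun e => hd' (by simpa using congrArg Subtype.val e)
      have hdu' : ¬ IsUnit (⟨_, hdR⟩ : R) := by
        rw [Subring.isUnit_iff_inv_mem hd] at hdu
        rwa [Subring.isUnit_iff_inv_mem hd0, ← map_inv₀, h.algebraMap_mem_iff]
      obtain ⟨i, j, hi, hj, u, e⟩ := hcomp _ _ hd0 hdu' hm0' (h.not_isUnit_of_valuation_lt hm)
      have := hval _ _ _ _ _ e
      rw [h.valuation_algebraMap hd', one_pow] at this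
      exact (pow_lt_one₀ zero_le hm hj.ne').ne this.symm
    refine ⟨⟨inferInstance, Subring.inclusion h.le a, ?_⟩, hD, fun k => ?_⟩
    · intro y hy hyu
      have hylt := (V.valuation_lt_one_iff y).mp hyu
      obtain ⟨i, j, hi, hj, u, e⟩ := ha ⟨y, h.mem_of_valuation_lt hylt⟩
        (fun e => hy (Subtype.ext (congrArg Subtype.val e : (y : L) = 0)))
        (h.not_isUnit_of_valuation_lt hylt)
      refine ⟨i, j, hi, hj, Units.map (Subring.inclusion h.le).toMonoidHom u, ?_⟩
      have e' : (y : L) ^ i = ((u : R) : L) * (a : L) ^ j := congrArg Subtype.val e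
      exact Subtype.ext e'
    · by_cases hk : k = 0
      · exact ⟨1, one_pos, by simp [hk]⟩
      have hlt : V.valuation (m * algebraMap K L k) < 1 := by rwa [h.valuation_mul_algebraMap hk]
      obtain ⟨i, j, hi, hj, u, e⟩ := hcomp ⟨_, h.mem_of_valuation_lt hlt⟩ ⟨m, hmR⟩
        (fun e => mul_ne_zero hm0 (by simpa using hk) (congrArg Subtype.val e))
        (h.not_isUnit_of_valuation_lt hlt) hm0' (h.not_isUnit_of_valuation_lt hm)
      have hv := hval _ _ _ _ _ e
      simp only [h.valuation_mul_algebraMap hk] at hv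
      have hij : i = j :=
        (pow_right_strictAnti₀ (zero_lt_iff.mpr hvm) hm).injective hv
      subst hij
      refine ⟨i, hi, ?_⟩
      have e' : (m * algebraMap K L k) ^ i = (u : R) * m ^ i := congrArg Subtype.val e
      rw [mul_pow, mul_comm, mul_left_inj' (pow_ne_zero i hm0), ← map_pow] at e'
      rw [← h.algebraMap_mem_iff, e']
      exact (u : R).2
  · rintro ⟨⟨-, a, ha⟩, hD, hroot⟩
    have halt := (V.valuation_lt_one_iff a).mp (ha.not_isUnit h.not_isField)
    refine ⟨h.not_isField_pullback, ⟨a, h.mem_of_valuation_lt halt⟩, fun y hy hyu => ?_⟩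
    have hylt := h.valuation_lt_of_not_isUnit hD hyu
    obtain ⟨i, j, hi, hj, u, e⟩ := ha ⟨y, h.le y.2⟩
      (fun e => hy (Subtype.ext (congrArg Subtype.val e : (y : L) = 0)))
      ((V.valuation_lt_one_iff _).mpr hylt)
    obtain ⟨n, hn, hu⟩ := hroot (π u)
    have hun : ((u : V) : L) ^ n ∈ R := (h.pow_mem_iff (u : V).2 n).mpr hu
    have hunit : IsUnit (⟨_, hun⟩ : R) := by
      by_contra hcon
      have := h.valuation_lt_of_not_isUnit hD hcon
      rw [map_pow, (V.valuation_eq_one_iff _).mp u.isUnit, one_pow] at this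
      exact lt_irrefl _ this
    refine ⟨i * n, j * n, Nat.mul_pos hi hn, Nat.mul_pos hj hn, hunit.unit, Subtype.ext ?_⟩
    have e' : (y : L) ^ i = ((u : V) : L) * (a : L) ^ j := congrArg Subtype.val e
    change (y : L) ^ (i * n) = ((u : V) : L) ^ n * (a : L) ^ (j * n)
    rw [pow_mul, e', mul_pow, pow_mul]

end IsCoefficientPullback

theorem Subring.isField_of_forall_mem_integralClosure {K : Type*} [Field K] {D : Subring K}
    (hint : ∀ k : K, k ∈ integralClosure D K) : IsField D := by
  have : Algebra.IsIntegral D K := ⟨hint⟩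
  exact isField_of_isIntegral_of_isField Subtype.val_injective (Field.toIsField K)

theorem Subring.eq_top_of_isField_of_closure_eq_top {K : Type*} [Field K] {D : Subring K}
    (hD : IsField D) (htop : Subfield.closure (D : Set K) = ⊤) : D = ⊤ := by
  rw [D.eq_closure_toSubring_iff_isField.mpr hD, htop]
  rfl

/-! ### Noetherian, discrete, rational and API-criteria -/

namespace IsCoefficientPullback

variable {K L : Type*} [Field K] [Field L] [Algebra K L] {V : ValuationSubring L} {π : V →+* K}
  {D : Subring K} {R : Subring L} (h : IsCoefficientPullback V π D R)
include h

/-- Multiplication by m embeds V into R as an R-module, so V is a finite R-module and a Noetherian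
ring. Applying π makes K finite over D, whence D is a field. -/
theorem isDiscreteValuationRing_and_finite_of_isNoetherianRing (hR : IsNoetherianRing R) :
    IsDiscreteValuationRing V ∧ IsField D ∧ Module.Finite D K := by
  obtain ⟨m, hm0, hm⟩ := h.exists_valuation_lt_one
  let : Algebra R V := (Subring.inclusion h.le).toAlgebra
  let f : V →ₗ[R] R :=
    { toFun := fun x => ⟨m * x, h.mem_of_valuation_lt (valuation_mul_lt_one hm x.2)⟩
      map_add' := fun x y => Subtype.ext (mul_add m (x : L) y)
      map_smul' := fun r x => Subtype.ext (mul_left_comm m (r : L) x) }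
  have hf : Function.Injective f := fun x y e =>
    Subtype.ext (mul_left_cancel₀ hm0 (congrArg Subtype.val e))
  have hV : IsNoetherian R V := isNoetherian_of_injective f hf
  have hVn : IsNoetherianRing V := isNoetherian_of_tower R hV
  obtain ⟨ρ, -, -, -, hρ⟩ := h.exists_ringHom
  have hfin : Module.Finite D K := by
    obtain ⟨s, hs⟩ := hV.noetherian ⊤
    classical
    refine ⟨s.image π, eq_top_iff.mpr fun k _ => ?_⟩
    have hk : (⟨_, h.algebraMap_mem k⟩ : V) ∈ Submodule.span R (s : Set V) := hs ▸ Submodule.mem_top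
    have key : ∀ x ∈ Submodule.span R (s : Set V), π x ∈ Submodule.span D (s.image π : Set K) := by
      intro x hx
      induction hx using Submodule.span_induction with
      | mem x hx => exact Submodule.subset_span (Finset.mem_coe.mpr (Finset.mem_image_of_mem π hx))
      | zero => rw [map_zero]; exact zero_mem _
      | add x y _ _ hx hy => rw [map_add]; exact add_mem hx hy
      | smul r x _ hx =>
        have : π (r • x) = ρ r • π x := by
          rw [Algebra.smul_def, map_mul]
          change _ = (ρ r : K) * π x
          rw [hρ]
          rfl
        rw [this]
        exact Submodule.smul_mem _ _ hx
    have := key _ hk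
    rwa [h.apply_algebraMap] at this
  refine ⟨?_, Subring.isField_of_forall_mem_integralClosure fun k => Algebra.IsIntegral.isIntegral k,
    hfin⟩
  have hval : ValuationRing V := inferInstance
  exact ((IsDiscreteValuationRing.TFAE V h.not_isField).out 0 1).mpr hval

/-- By Cohen's theorem only prime ideals matter. A nonzero prime is M = tV, the image under
multiplication by t of V, which is a finite R-module generated by 1 and generators of K over D. -/
theorem isNoetherianRing_of_isDiscreteValuationRing (hV : IsDiscreteValuationRing V)
    (hD : IsField D) (hfin : Module.Finite D K) : IsNoetherianRing R := by
  let : Algebra R V := (Subring.inclusion h.le).toAlgebra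
  have hfinV : Module.Finite R V := by
    obtain ⟨s, hs⟩ := hfin.fg_top
    let ι : K → V := fun k => ⟨_, h.algebraMap_mem k⟩
    classical
    refine ⟨insert 1 (s.image ι), eq_top_iff.mpr fun y _ => ?_⟩
    set N := Submodule.span R ((insert 1 (s.image ι) : Finset V) : Set V)
    have key : ∀ k ∈ Submodule.span D (s : Set K), ι k ∈ N := by
      intro k hk
      induction hk using Submodule.span_induction with
      | mem k hk => exact Submodule.subset_span (by simpa using .inr ⟨k, hk, rfl⟩)
      | zero =>
        have : ι 0 = 0 := Subtype.ext (map_zero _)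
        rw [this]
        exact zero_mem _
      | add x y _ _ hx hy =>
        have : ι (x + y) = ι x + ι y := Subtype.ext (map_add _ _ _)
        rw [this]
        exact add_mem hx hy
      | smul d x _ hx =>
        have : ι (d • x) = (⟨_, (h.algebraMap_mem_iff d).mpr d.2⟩ : R) • ι x :=
          Subtype.ext (map_mul (algebraMap K L) (d : K) x)
        rw [this]
        exact Submodule.smul_mem _ _ hx
    have h1 := key (π y) (hs ▸ Submodule.mem_top)
    have h2 : y = (⟨_, h.mem_of_valuation_lt (h.valuation_sub_lt_one y.2)⟩ : R) • (1 : V) +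
        ι (π y) := by
      rw [Algebra.smul_def, mul_one]
      exact Subtype.ext (sub_add_cancel (y : L) _).symm
    rw [h2]
    exact add_mem (Submodule.smul_mem _ _ (Submodule.subset_span (by simp))) h1
  obtain ⟨t, ht⟩ := IsDiscreteValuationRing.exists_irreducible V
  have htv : V.valuation (t : L) < 1 :=
    (V.valuation_lt_one_iff t).mp (by simp [ht.maximalIdeal_eq])
  let f : V →ₗ[R] R :=
    { toFun := fun x => ⟨t * x, h.mem_of_valuation_lt (valuation_mul_lt_one htv x.2)⟩
      map_add' := fun x y => Subtype.ext (mul_add (t : L) (x : L) y)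
      map_smul' := fun r x => Subtype.ext (mul_left_comm (t : L) (r : L) x) }
  refine IsNoetherianRing.of_prime fun P hP => ?_
  by_cases hP0 : P = ⊥
  · rw [hP0]
    exact Submodule.fg_bot
  obtain ⟨x, hx, hx0⟩ := Submodule.exists_mem_ne_zero_of_ne_bot hP0
  have hPf : P = LinearMap.range f := by
    apply le_antisymm
    · intro y hy
      have hylt := h.valuation_lt_of_not_isUnit hD fun hu => hP.ne_top (P.eq_top_of_isUnit_mem hy hu)
      have hym := (V.valuation_lt_one_iff ⟨y, h.le y.2⟩).mpr hylt
      rw [ht.maximalIdeal_eq, Ideal.mem_span_singleton] at hym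
      obtain ⟨z, hz⟩ := hym
      exact ⟨z, Subtype.ext (congrArg Subtype.val hz).symm⟩
    · rintro _ ⟨z, rfl⟩
      have hx0' : (⟨x, h.le x.2⟩ : V) ≠ 0 := fun e => hx0 (Subtype.ext (congrArg Subtype.val e :))
      obtain ⟨n, hn⟩ := IsDiscreteValuationRing.exists_maximalIdeal_pow_le hx0'
      have hlt : V.valuation ((f z : R) : L) < 1 := valuation_mul_lt_one htv z.2
      have hmem : (⟨f z, h.le (f z).2⟩ : V) ∈ IsLocalRing.maximalIdeal V :=
        (V.valuation_lt_one_iff _).mpr hlt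
      obtain ⟨w, hw⟩ := Ideal.mem_span_singleton.mp (hn (Ideal.pow_mem_pow hmem n))
      have hw' : ((f z : R) : L) ^ n = x * w := congrArg Subtype.val hw
      -- The cofactor w lies only in V; one more factor from M moves it into R.
      refine hP.mem_of_pow_mem (n + 1) ?_
      have : f z ^ (n + 1) =
          x * ⟨(f z : R) * w, h.mem_of_valuation_lt (valuation_mul_lt_one hlt w.2)⟩ := by
        refine Subtype.ext ?_
        change ((f z : R) : L) ^ (n + 1) = x * ((f z : R) * w)
        rw [pow_succ, hw']
        ring
      rw [this]
      exact P.mul_mem_right _ hx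
  rw [hPf, LinearMap.range_eq_map]
  exact hfinV.fg_top.map f

theorem isNoetherianRing_iff : IsNoetherianRing R ↔
    IsDiscreteValuationRing V ∧ IsField D ∧ Module.Finite D K :=
  ⟨h.isDiscreteValuationRing_and_finite_of_isNoetherianRing,
    fun ⟨h1, h2, h3⟩ => h.isNoetherianRing_of_isDiscreteValuationRing h1 h2 h3⟩

theorem isLocalRing_of_isField (hD : IsField D) : IsLocalRing R := by
  rw [h.isLocalRing_iff]
  let := hD.toField
  infer_instance

theorem isDiscreteValuationRing_iff :
    IsDiscreteValuationRing R ↔ D = ⊤ ∧ IsDiscreteValuationRing V := by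
  constructor
  · intro hR
    obtain ⟨hV, hD, -⟩ := h.isNoetherianRing_iff.mp inferInstance
    exact ⟨Subring.eq_top_of_isField_of_closure_eq_top hD (h.valuationRing_iff.mp inferInstance).2, hV⟩
  · rintro ⟨hD, hV⟩
    obtain rfl := h.eq_valuationSubring_iff.mpr hD
    exact hV

theorem isRationalValuationDomain_iff :
    IsRationalValuationDomain R ↔ D = ⊤ ∧ IsRationalValuationDomain V := by
  constructor
  · intro hR
    obtain ⟨hval, ha⟩ := (_root_.isRationalValuationDomain_iff h.not_isField_pullback).mp hR
    obtain ⟨hV, hD, -⟩ := h.isRAVDomain_iff.mp ⟨h.not_isField_pullback, ha⟩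
    exact ⟨Subring.eq_top_of_isField_of_closure_eq_top hD (h.valuationRing_iff.mp hval).2, hV⟩
  · rintro ⟨hD, hV⟩
    obtain rfl := h.eq_valuationSubring_iff.mpr hD
    exact hV

theorem exists_forall_div_pow_mem [IsLocalRing R] (hR : IsAPIDomain R) {S : Set L}
    (hS : S.Nonempty) (h0 : ∀ s ∈ S, s ≠ 0) (hlt : ∀ s ∈ S, V.valuation s < 1) :
    ∃ n : ℕ, 0 < n ∧ ∃ s ∈ S, ∀ t ∈ S, (t / s) ^ n ∈ R := by
  obtain ⟨s₀, hs₀⟩ := hS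
  obtain ⟨n, hn, hp⟩ := hR (Subtype.val ⁻¹' S)
    ⟨⟨s₀, h.mem_of_valuation_lt (hlt _ hs₀)⟩, hs₀⟩ (fun s hs e => h0 _ hs (by simp [e]))
  obtain ⟨_, ⟨s, hs, rfl⟩, hd⟩ := exists_mem_dvd_of_isPrincipal_span
    (Set.Nonempty.image _ ⟨⟨s₀, h.mem_of_valuation_lt (hlt _ hs₀)⟩, hs₀⟩) hp
  refine ⟨n, hn, s, hs, fun t ht => ?_⟩
  have := (Subring.dvd_iff_div_mem (pow_ne_zero n fun e => h0 _ hs (by simp [e]))).mp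
    (hd _ ⟨⟨t, h.mem_of_valuation_lt (hlt t ht)⟩, ht, rfl⟩)
  rw [div_pow]
  exact this

/-- Three test sets inside M are used: m I for an ideal I of V, the elements m d⁻¹ ^ j for d ∈ D,
and the nonzero multiples m k. They show in turn that I is principal, that d⁻¹ ∈ D, and that one
exponent serves all of K. Conversely, in a DVR some s ∈ S divides all of S, and n-th powers bring
the cofactors into R. -/
theorem isLocalRing_and_isAPIDomain_iff : IsLocalRing R ∧ IsAPIDomain R ↔
    IsDiscreteValuationRing V ∧ IsField D ∧ ∃ n : ℕ, 0 < n ∧ ∀ k : K, k ^ n ∈ D := by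
  obtain ⟨m, hm0, hm⟩ := h.exists_valuation_lt_one
  constructor
  · rintro ⟨hloc, hR⟩
    refine ⟨?_, ?_, ?_⟩
    · have hpid : IsPrincipalIdealRing V := by
        refine ⟨fun I => ?_⟩
        by_cases hI : I = ⊥
        · exact hI ▸ bot_isPrincipal
        obtain ⟨x, hx, hx0⟩ := Submodule.exists_mem_ne_zero_of_ne_bot hI
        obtain ⟨n, hn, _, ⟨y, ⟨hy, hy0⟩, rfl⟩, H⟩ := h.exists_forall_div_pow_mem hR
          (S := (fun x : V => m * (x : L)) '' {x | x ∈ I ∧ x ≠ 0}) ⟨_, x, ⟨hx, hx0⟩, rfl⟩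
          (by rintro _ ⟨x, ⟨-, hx⟩, rfl⟩; exact mul_ne_zero hm0 (fun e => hx (Subtype.ext e)))
          (by rintro _ ⟨x, -, rfl⟩; exact valuation_mul_lt_one hm x.2)
        have hy0' : (y : L) ≠ 0 := fun e => hy0 (Subtype.ext e)
        refine ⟨y, le_antisymm (fun z hz => ?_) ((Ideal.span_singleton_le_iff_mem I).mpr hy)⟩
        by_cases hz0 : z = 0
        · exact hz0 ▸ zero_mem _
        have h1 := h.le (H _ ⟨z, ⟨hz, hz0⟩, rfl⟩)
        rw [mul_div_mul_left _ _ hm0] at h1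
        have h2 : (z / y : L) ∈ V := by
          have h3 : V.valuation ((z / y : L) ^ n) ≤ 1 := (V.valuation_le_one_iff _).mpr h1
          rw [map_pow] at h3
          exact (V.valuation_le_one_iff _).mp ((pow_le_one_iff hn.ne').mp h3)
        exact Ideal.mem_span_singleton.mpr
          ⟨⟨_, h2⟩, Subtype.ext (mul_div_cancel₀ (z : L) hy0').symm⟩
      exact ⟨fun e => h.not_isField (IsLocalRing.isField_iff_maximalIdeal_eq.mpr e)⟩
    · rw [Subring.isField_iff_inv_mem]
      intro d hd
      by_cases hd0 : d = 0
      · simp [hd0]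
      have hd0' : algebraMap K L d ≠ 0 := by simpa using hd0
      obtain ⟨n, hn, _, ⟨j, rfl⟩, H⟩ := h.exists_forall_div_pow_mem hR
        (S := Set.range fun j : ℕ => m * algebraMap K L (d⁻¹ ^ j)) (Set.range_nonempty _)
        (by rintro _ ⟨j, rfl⟩; exact mul_ne_zero hm0 (by simpa using fun e => absurd e hd0))
        (by rintro _ ⟨j, rfl⟩; exact valuation_mul_lt_one hm (h.algebraMap_mem _))
      have h1 := H _ ⟨j + 1, rfl⟩
      simp only at h1
      rw [mul_div_mul_left _ _ hm0, ← map_div₀, pow_succ,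
        mul_div_cancel_left₀ _ (pow_ne_zero j (inv_ne_zero hd0)), ← map_pow,
        h.algebraMap_mem_iff] at h1
      obtain ⟨i, rfl⟩ : ∃ i, n = i + 1 := ⟨n - 1, by omega⟩
      have h2 := D.mul_mem h1 (D.pow_mem hd i)
      have h3 : d⁻¹ ^ (i + 1) * d ^ i = d⁻¹ := by
        rw [pow_succ, mul_right_comm, ← mul_pow, inv_mul_cancel₀ hd0, one_pow, one_mul]
      rwa [h3] at h2
    · obtain ⟨n, hn, _, ⟨j, hj, rfl⟩, H⟩ := h.exists_forall_div_pow_mem hR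
        (S := (fun k : K => m * algebraMap K L k) '' {0}ᶜ) ⟨_, 1, one_ne_zero, rfl⟩
        (by rintro _ ⟨k, hk, rfl⟩; exact mul_ne_zero hm0 (by simpa using hk))
        (by rintro _ ⟨k, -, rfl⟩; exact valuation_mul_lt_one hm (h.algebraMap_mem _))
      refine ⟨n, hn, fun k => ?_⟩
      by_cases hk : k = 0
      · simp [hk, hn.ne']
      have hj0 : j ≠ 0 := hj
      have h1 := H _ ⟨k * j, mul_ne_zero hk hj0, rfl⟩
      simp only at h1
      rwa [mul_div_mul_left _ _ hm0, ← map_div₀, mul_div_cancel_right₀ _ hj0, ← map_pow,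
        h.algebraMap_mem_iff] at h1
  · rintro ⟨hV, hD, n, hn, hk⟩
    refine ⟨h.isLocalRing_of_isField hD, fun S hS h0 => ⟨n, hn, ?_⟩⟩
    obtain ⟨_, ⟨s, hs, rfl⟩, hd⟩ := exists_mem_dvd_of_isPrincipal_span
      (hS.image (Subring.inclusion h.le))
      (IsPrincipalIdealRing.principal (Ideal.span (Subring.inclusion h.le '' S) : Ideal V))
    refine ⟨s ^ n, le_antisymm (Ideal.span_le.mpr ?_)
      ((Ideal.span_singleton_le_iff_mem _).mpr (Ideal.subset_span ⟨s, hs, rfl⟩))⟩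
    rintro _ ⟨t, ht, rfl⟩
    obtain ⟨z, hz⟩ := hd _ ⟨t, ht, rfl⟩
    have hz' : (t : L) = s * z := congrArg Subtype.val hz
    refine Ideal.mem_span_singleton.mpr ⟨⟨_, (h.pow_mem_iff z.2 n).mpr (hk (π z))⟩,
      Subtype.ext ?_⟩
    change (t : L) ^ n = (s : L) ^ n * (z : L) ^ n
    rw [hz', mul_pow]

/-! ### Powers of the maximal ideal -/

/-- If d were a nonzero nonunit of D, then m = d ^ n · (m d⁻¹ ^ n) would lie in every power of the
maximal ideal. -/
theorem isField_of_forall_ne_zero_exists_notMem_pow [IsLocalRing R]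
    (H : ∀ x : R, x ≠ 0 → V.valuation (x : L) < 1 → ∃ d : ℕ,
      x ∉ IsLocalRing.maximalIdeal R ^ d) : IsField D := by
  rw [Subring.isField_iff_inv_mem]
  intro d hd
  by_contra hdi
  have hd0 : d ≠ 0 := by
    rintro rfl
    simp at hdi
  have hd0' : algebraMap K L d ≠ 0 := by simpa using hd0
  obtain ⟨m, hm0, hm⟩ := h.exists_valuation_lt_one
  obtain ⟨n, hn⟩ := H ⟨m, h.mem_of_valuation_lt hm⟩ (fun e => hm0 (congrArg Subtype.val e)) hm
  refine hn ?_
  let δ : R := ⟨_, (h.algebraMap_mem_iff d).mpr hd⟩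
  have hδ : δ ∈ IsLocalRing.maximalIdeal R := by
    rw [IsLocalRing.mem_maximalIdeal, mem_nonunits_iff,
      Subring.isUnit_iff_inv_mem (fun e => hd0' (congrArg Subtype.val e)), ← map_inv₀,
      h.algebraMap_mem_iff]
    exact hdi
  have : (⟨m, h.mem_of_valuation_lt hm⟩ : R) =
      δ ^ n * ⟨_, h.mem_of_valuation_lt (valuation_mul_lt_one hm (h.algebraMap_mem (d⁻¹ ^ n)))⟩ := by
    refine Subtype.ext ?_
    change m = algebraMap K L d ^ n * (m * algebraMap K L (d⁻¹ ^ n))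
    rw [map_pow, map_inv₀, inv_pow]
    field_simp
  rw [this]
  exact Ideal.mul_mem_right _ _ (Ideal.pow_mem_pow hδ n)

theorem isDiscreteValuationRing_of_iInf_pow_eq_bot [IsLocalRing R]
    (H : (⨅ n : ℕ, IsLocalRing.maximalIdeal R ^ n) = ⊥) :
    IsDiscreteValuationRing V ∧ IsField D := by
  have hH : ∀ x : R, x ≠ 0 → ∃ n : ℕ, x ∉ IsLocalRing.maximalIdeal R ^ n := by
    intro x hx
    by_contra! hcon
    have : x ∈ (⨅ n : ℕ, IsLocalRing.maximalIdeal R ^ n) := by simpa [Ideal.mem_iInf] using hcon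
    rw [H] at this
    exact hx this
  have hD := h.isField_of_forall_ne_zero_exists_notMem_pow fun x hx _ => hH x hx
  refine ⟨?_, hD⟩
  have hQ : ∀ x : R, x ∈ IsLocalRing.maximalIdeal R ↔ V.valuation (x : L) < 1 := fun x =>
    ⟨fun hx => h.valuation_lt_of_not_isUnit hD hx, fun hx => h.not_isUnit_of_valuation_lt hx⟩
  obtain ⟨m, hm0, hm⟩ := h.exists_valuation_lt_one
  obtain ⟨t, ht, hdvd⟩ : ∃ t : V, V.valuation (t : L) < 1 ∧
      ∀ y : V, V.valuation (y : L) < 1 → t ∣ y := by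
    by_contra! hcon
    -- Without a generator of M, each x ∈ M factors as y z with y, z ∈ M, so the maximal ideal Q = M
    -- of R satisfies Q = Q² and equals all its positive powers.
    have hle : IsLocalRing.maximalIdeal R ≤
        IsLocalRing.maximalIdeal R * IsLocalRing.maximalIdeal R := by
      intro x hx
      have hxlt := (hQ x).mp hx
      obtain ⟨y, hy, hxy⟩ := hcon ⟨x, h.le x.2⟩ hxlt
      obtain ⟨z, hz⟩ := (ValuationRing.dvd_total _ _).resolve_left hxy
      have hz' : (x : L) = y * z := congrArg Subtype.val hz
      have hzlt : V.valuation (z : L) < 1 := by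
        rw [← V.valuation_lt_one_iff]
        intro hu
        exact hxy (hz ▸ (hu.mul_right_dvd.mpr dvd_rfl))
      have : x = ⟨y, h.mem_of_valuation_lt hy⟩ * ⟨z, h.mem_of_valuation_lt hzlt⟩ := Subtype.ext hz'
      rw [this]
      exact Ideal.mul_mem_mul ((hQ _).mpr hy) ((hQ _).mpr hzlt)
    have hpow : ∀ n : ℕ, IsLocalRing.maximalIdeal R ≤ IsLocalRing.maximalIdeal R ^ n := by
      intro n
      induction n with
      | zero => simp
      | succ n ih =>
        rw [pow_succ]
        exact hle.trans (Ideal.mul_mono_left ih)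
    obtain ⟨n, hn⟩ := hH ⟨m, h.mem_of_valuation_lt hm⟩ fun e => hm0 (congrArg Subtype.val e)
    exact hn (hpow n ((hQ _).mpr hm))
  have htu : ¬ IsUnit t := fun hu => ht.ne ((V.valuation_eq_one_iff t).mp hu)
  have hnu : ∀ {y : V}, ¬ IsUnit y → t ∣ y := fun {y} hy =>
    hdvd y ((V.valuation_lt_one_iff y).mp hy)
  have ht0 : t ≠ 0 := by
    rintro rfl
    have := hdvd ⟨m, (V.valuation_le_one_iff m).mp hm.le⟩ hm
    exact hm0 (congrArg Subtype.val (zero_dvd_iff.mp this))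
  have hirr : Irreducible t := by
    refine ⟨htu, fun a b hab => ?_⟩
    by_contra! hcon
    obtain ⟨c, rfl⟩ := hnu hcon.1
    refine hcon.2 (IsUnit.of_mul_eq_one_right c (mul_left_cancel₀ ht0 ?_))
    rw [mul_one, ← mul_assoc]
    exact hab.symm
  refine IsDiscreteValuationRing.ofHasUnitMulPowIrreducibleFactorization ⟨t, hirr, ?_⟩
  intro x hx
  -- An x divisible by every t ^ n lies in all Q ^ n: one spare factor t keeps the cofactor t z
  -- inside R.
  have hex : ∃ n : ℕ, ¬ t ^ n ∣ x := by
    by_contra! hcon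
    obtain ⟨c, hc⟩ := hcon 1
    rw [pow_one] at hc
    have hxR : (x : L) ∈ R := h.mem_of_valuation_lt (by
      rw [hc]
      exact valuation_mul_lt_one ht c.2)
    obtain ⟨n, hn⟩ := hH ⟨x, hxR⟩ fun e => hx (Subtype.ext (congrArg Subtype.val e :))
    obtain ⟨z, hz⟩ := hcon (n + 1)
    have : (⟨x, hxR⟩ : R) = ⟨t, h.mem_of_valuation_lt ht⟩ ^ n *
        ⟨t * z, h.mem_of_valuation_lt (valuation_mul_lt_one ht z.2)⟩ := by
      refine Subtype.ext ?_
      change (x : L) = (t : L) ^ n * (t * z)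
      rw [← mul_assoc, ← pow_succ]
      exact congrArg Subtype.val hz
    rw [this] at hn
    exact hn (Ideal.mul_mem_right _ _ (Ideal.pow_mem_pow ((hQ _).mpr ht) n))
  classical
  obtain ⟨n, hn⟩ : ∃ n, Nat.find hex = n + 1 := by
    refine Nat.exists_eq_add_one.mpr ((Nat.find_pos hex).mpr ?_)
    simp
  obtain ⟨y, hy⟩ := not_not.mp (Nat.find_min hex (m := n) (by omega))
  refine ⟨n, ?_⟩
  have hyu : IsUnit y := by
    by_contra hyu
    obtain ⟨c, rfl⟩ := hnu hyu
    refine Nat.find_spec hex ⟨c, ?_⟩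
    rw [hn, hy, pow_succ, mul_assoc]
  exact ⟨hyu.unit, hy.symm⟩

/-- For 0 ≠ x ∈ A some M ^ n ⊆ x V; a further factor from M gives x M ⊆ x R ⊆ A. -/
theorem exists_maximalIdeal_pow_le [IsLocalRing R] (hV : IsDiscreteValuationRing V)
    (hD : IsField D) {A : Ideal R} (hA : A ≠ ⊥) :
    ∃ n : ℕ, 0 < n ∧ IsLocalRing.maximalIdeal R ^ n ≤ A := by
  obtain ⟨x, hx, hx0⟩ := Submodule.exists_mem_ne_zero_of_ne_bot hA
  have hx0' : (⟨x, h.le x.2⟩ : V) ≠ 0 := fun e => hx0 (Subtype.ext (congrArg Subtype.val e :))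
  obtain ⟨n, hn⟩ := IsDiscreteValuationRing.exists_maximalIdeal_pow_le hx0'
  have hcomap : IsLocalRing.maximalIdeal R ≤
      (IsLocalRing.maximalIdeal V).comap (Subring.inclusion h.le) := fun y hy =>
    (V.valuation_lt_one_iff ⟨y, h.le y.2⟩).mpr (h.valuation_lt_of_not_isUnit hD hy)
  refine ⟨n + 1, n.succ_pos, ?_⟩
  rw [pow_succ, Ideal.mul_le]
  intro a ha b hb
  obtain ⟨z, hz⟩ := Ideal.mem_span_singleton.mp
    (hn (Ideal.le_comap_pow _ n (Ideal.pow_right_mono hcomap n ha)))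
  have hz' : (a : L) = x * z := congrArg Subtype.val hz
  have hblt := h.valuation_lt_of_not_isUnit hD hb
  have : a * b = x * ⟨b * z, h.mem_of_valuation_lt (valuation_mul_lt_one hblt z.2)⟩ := by
    refine Subtype.ext ?_
    change (a : L) * b = x * (b * z)
    rw [hz']
    ring
  rw [this]
  exact A.mul_mem_right _ hx

/-- A nonzero x in all powers would lie in the ideal generated by x μ, making the nonunit μ
invertible. The term n = 0 is the whole ring and does not affect the intersection. -/
theorem iInf_maximalIdeal_pow_eq_bot [IsLocalRing R]
    (H : ∀ A : Ideal R, A ≠ ⊥ → A ≠ ⊤ → ∃ n : ℕ, 0 < n ∧ IsLocalRing.maximalIdeal R ^ n ≤ A) :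
    (⨅ n : ℕ, IsLocalRing.maximalIdeal R ^ n) = ⊥ := by
  refine eq_bot_iff.mpr fun x hx => ?_
  by_contra hx0
  have hx0 : x ≠ 0 := hx0
  obtain ⟨m, hm0, hm⟩ := h.exists_valuation_lt_one
  let μ : R := ⟨m, h.mem_of_valuation_lt hm⟩
  have hμ : ¬ IsUnit μ := h.not_isUnit_of_valuation_lt hm
  have hμ0 : μ ≠ 0 := fun e => hm0 (congrArg Subtype.val e)
  obtain ⟨n, -, hn⟩ := H (Ideal.span {x * μ})
    (by rw [Ne, Ideal.span_singleton_eq_bot]; exact mul_ne_zero hx0 hμ0)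
    (by rw [Ne, Ideal.span_singleton_eq_top]; exact fun hu => hμ (isUnit_of_mul_isUnit_right hu))
  obtain ⟨r, hr⟩ := Ideal.mem_span_singleton.mp (hn ((Ideal.mem_iInf.mp hx) n))
  refine hμ (IsUnit.of_mul_eq_one r (mul_left_cancel₀ hx0 ?_))
  rw [mul_one, ← mul_assoc]
  exact hr.symm

end IsCoefficientPullback

/-! ### The theorem, assembled from the criteria -/

theorem theorem08 {K L : Type*} [Field K] [Field L] [Algebra K L]
    (V : ValuationSubring L) (hV : ¬ IsField V)
    (hKV : ∀ k : K, algebraMap K L k ∈ V)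
    (hsum : plusMaxIdeal V hKV (⊤ : Subring K) = V.toSubring)
    (D : Subring K)
    (F : Subfield K) (hF : F = Subfield.closure (D : Set K))
    (R : Subring L) (hR : R = plusMaxIdeal V hKV D) :
    -- `R` is a subring of `V` whose quotient field is `L`
    (R ≤ V.toSubring ∧ IsFractionRing R L) ∧
    -- (1)
    ((R = V.toSubring ↔ D = ⊤) ∧
      (R < V.toSubring →
        conductorSet R V.toSubring = Subtype.val '' (IsLocalRing.maximalIdeal V : Set V))) ∧
    -- (2)
    ((integralClosure R L).toSubring = plusMaxIdeal V hKV (integralClosure D K).toSubring) ∧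
    -- (3)
    (IsLocalRing R ↔ IsLocalRing D) ∧
    -- (4)
    [IsNoetherianLocal R,
      IsNoetherianRing R,
      IsDiscreteValuationRing V ∧ D = F.toSubring ∧ FiniteDimensional F K].TFAE ∧
    -- (5)
    (ValuationRing R ↔ ValuationRing D ∧ F = ⊤) ∧
    -- (6)
    ([IsDiscreteValuationRing R,
        D = ⊤ ∧ IsDiscreteValuationRing V,
        R = V.toSubring ∧ IsDiscreteValuationRing V].TFAE ∧
      [IsRationalValuationDomain R,
        D = ⊤ ∧ IsRationalValuationDomain V,
        R = V.toSubring ∧ IsRationalValuationDomain V].TFAE) ∧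
    -- (7)
    ((IsRootExtension R (integralClosure R L) ↔ IsRootExtension D (integralClosure D K)) ∧
      (IsBoundedRootExtension R (integralClosure R L) ↔
        IsBoundedRootExtension D (integralClosure D K))) ∧
    -- (8)
    ([IsAVDomain R,
        (ValuationRing (integralClosure D K) ∧ IsFractionRing (integralClosure D K) K) ∧
          IsRootExtension D (integralClosure D K),
        IsAVDomain D ∧ IsRootExtension F K].TFAE ∧
      (IsRootExtension F K ↔
        IsPurelyInseparable F K ∨ ∃ k : Subfield K, Finite k ∧ Algebra.IsAlgebraic k K)) ∧
    -- (9)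
    ([IsAVDomain R ∧ IsDiscreteValuationRing (integralClosure R L),
        IsAVDomain R ∧ ∃ _ : IsLocalRing R, (⨅ n : ℕ, IsLocalRing.maximalIdeal R ^ n) = ⊥,
        IsAVDomain R ∧ ∃ _ : IsLocalRing R, ∀ A : Ideal R, A ≠ ⊥ → A ≠ ⊤ →
          ∃ n : ℕ, 0 < n ∧ IsLocalRing.maximalIdeal R ^ n ≤ A,
        IsDiscreteValuationRing V ∧ D = F.toSubring ∧ IsRootExtension F K].TFAE ∧
      (IsAVDomain R ∧ IsDiscreteValuationRing (integralClosure R L) →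
        (integralClosure R L).toSubring = V.toSubring)) ∧
    -- (10)
    (IsNoetherianLocal R ∧ IsAVDomain R ↔
      IsDiscreteValuationRing V ∧ D = F.toSubring ∧ FiniteDimensional F K ∧
        IsRootExtension F K) ∧
    -- (11)
    ((IsLocalRing R ∧ IsAPIDomain R ↔
        IsDiscreteValuationRing V ∧ D = F.toSubring ∧ IsBoundedRootExtension F K) ∧
      (IsBoundedRootExtension F K ↔
        (IsPurelyInseparable F K ∧ IsPurelyInseparable.HasExponent F K) ∨ Finite K)) ∧
    -- (12)
    (IsNoetherianLocal R ∧ IsAPIDomain R ↔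
      IsDiscreteValuationRing V ∧ D = F.toSubring ∧ FiniteDimensional F K ∧
        IsBoundedRootExtension F K) ∧
    -- (13)
    (IsRAVDomain R ↔
      IsRationalValuationDomain V ∧ D = F.toSubring ∧ IsRootExtension F K) := by
  obtain ⟨π, hπ⟩ := exists_ringHom_isCoefficientPullback V hV hKV hsum
  have h : IsCoefficientPullback V π D R := hR ▸ hπ D
  have hDF : D = F.toSubring ↔ IsField D := hF ▸ D.eq_closure_toSubring_iff_isField
  have hroot : IsField D → (IsRootExtension F K ↔ ∀ k : K, ∃ n : ℕ, 0 < n ∧ k ^ n ∈ D) := by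
    intro hD
    rw [isRootExtension_subfield_iff, hDF.mpr hD]
    rfl
  have hbroot : IsField D →
      (IsBoundedRootExtension F K ↔ ∃ n : ℕ, 0 < n ∧ ∀ k : K, k ^ n ∈ D) := by
    intro hD
    rw [isBoundedRootExtension_subfield_iff, hDF.mpr hD]
    rfl
  have hfin : IsField D → (FiniteDimensional F K ↔ Module.Finite D K) := by
    intro hD
    rw [hDF.mpr hD]
    rfl
  have hnoeth : IsNoetherianRing R ↔
      IsDiscreteValuationRing V ∧ D = F.toSubring ∧ FiniteDimensional F K := by
    rw [h.isNoetherianRing_iff, hDF]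
    exact and_congr_right fun _ => and_congr_right fun hD => (hfin hD).symm
  have hnoethloc : IsNoetherianLocal R ↔
      IsDiscreteValuationRing V ∧ D = F.toSubring ∧ FiniteDimensional F K :=
    ⟨fun hn => hnoeth.mp hn.1, fun hn => ⟨hnoeth.mpr hn, h.isLocalRing_of_isField (hDF.mp hn.2.1)⟩⟩
  have hAV : IsAVDomain R ↔ IsAVDomain D ∧ IsRootExtension F K := by
    rw [h.isAVDomain_iff, D.forall_pow_mem_or_inv_pow_mem_iff_isAVDomain,
      isRootExtension_subfield_iff, hF]
  have hAVfield : IsField D → (IsAVDomain R ↔ IsRootExtension F K) := by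
    intro hD
    rw [hAV, and_iff_right_iff_imp]
    intro _ a b ha _
    obtain ⟨c, hc⟩ := hD.mul_inv_cancel ha
    refine ⟨1, one_pos, .inl ?_⟩
    rw [pow_one, pow_one]
    exact (IsUnit.of_mul_eq_one c hc).dvd
  have hAPI : IsLocalRing R ∧ IsAPIDomain R ↔
      IsDiscreteValuationRing V ∧ D = F.toSubring ∧ IsBoundedRootExtension F K := by
    rw [h.isLocalRing_and_isAPIDomain_iff, hDF]
    exact and_congr_right fun _ => and_congr_right fun hD => (hbroot hD).symm
  have hclosure : IsAVDomain R ∧ IsDiscreteValuationRing (integralClosure R L) →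
      (integralClosure R L).toSubring = V.toSubring ∧ IsDiscreteValuationRing V ∧ IsField D := by
    rintro ⟨-, hdvr⟩
    -- The DVR criterion is applied to the integral closure in place of R: it forces K to be
    -- integral over D, so D is a field.
    obtain ⟨htop, hVd⟩ := h.pullback_integralClosure.isDiscreteValuationRing_iff.mp hdvr
    refine ⟨h.pullback_integralClosure.eq_valuationSubring_iff.mpr htop, hVd, ?_⟩
    exact Subring.isField_of_forall_mem_integralClosure fun k =>
      (htop.ge (Subring.mem_top k) : k ∈ (integralClosure D K).toSubring)
  refine ⟨⟨h.le, h.isFractionRing⟩, ⟨h.eq_valuationSubring_iff, h.conductorSet_eq⟩, ?_,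
    h.isLocalRing_iff, ?_, ?_, ⟨?_, ?_⟩, ⟨?_, ?_⟩,
    ⟨?_, isRootExtension_iff_isPurelyInseparable_or K F⟩,
    ⟨?_, fun H => (hclosure H).1⟩, ?_,
    ⟨hAPI, isBoundedRootExtension_iff_hasExponent_or_finite K F⟩, ?_, ?_⟩
  · ext x
    rw [(hπ _).mem_iff]
    exact h.mem_integralClosure_iff_apply_mem x
  · tfae_have 1 ↔ 3 := hnoethloc
    tfae_have 2 ↔ 3 := hnoeth
    tfae_finish
  · rw [h.valuationRing_iff, hF]
  · tfae_have 1 ↔ 2 := h.isDiscreteValuationRing_iff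
    tfae_have 2 ↔ 3 := and_congr_left fun _ => h.eq_valuationSubring_iff.symm
    tfae_finish
  · tfae_have 1 ↔ 2 := h.isRationalValuationDomain_iff
    tfae_have 2 ↔ 3 := and_congr_left fun _ => h.eq_valuationSubring_iff.symm
    tfae_finish
  · rw [isRootExtension_integralClosure_iff, isRootExtension_integralClosure_iff]
    exact h.forall_exists_pow_mem_iff h.pullback_integralClosure
  · rw [isBoundedRootExtension_integralClosure_iff, isBoundedRootExtension_integralClosure_iff]
    exact exists_congr fun n => and_congr_right fun _ =>
      h.forall_pow_mem_iff h.pullback_integralClosure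
  · tfae_have 1 ↔ 2 := by
      rw [h.isAVDomain_iff, D.forall_pow_mem_or_inv_pow_mem_iff_integralClosure,
        isRootExtension_integralClosure_iff]
      exact and_congr_left fun _ =>
        (Subring.valuationRing_and_isFractionRing_iff (integralClosure D K).toSubring).symm
    tfae_have 1 ↔ 3 := hAV
    tfae_finish
  · tfae_have 1 → 4 := by
      intro H
      obtain ⟨-, hVd, hD⟩ := hclosure H
      exact ⟨hVd, hDF.mpr hD, (hAVfield hD).mp H.1⟩
    tfae_have 4 → 1 := by
      rintro ⟨hVd, hD, hr⟩
      have hDf := hDF.mp hD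
      refine ⟨(hAVfield hDf).mpr hr,
        h.pullback_integralClosure.isDiscreteValuationRing_iff.mpr
          ⟨eq_top_iff.mpr fun k _ => ?_, hVd⟩⟩
      obtain ⟨n, hn, hk⟩ := (hroot hDf).mp hr k
      exact IsIntegral.of_pow hn (isIntegral_algebraMap (x := (⟨_, hk⟩ : D)))
    tfae_have 4 → 3 := by
      rintro ⟨hVd, hD, hr⟩
      have hDf := hDF.mp hD
      have hloc := h.isLocalRing_of_isField hDf
      exact ⟨(hAVfield hDf).mpr hr, hloc, fun A hA _ => h.exists_maximalIdeal_pow_le hVd hDf hA⟩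
    tfae_have 3 → 2 := by
      rintro ⟨hav, hloc, H⟩
      exact ⟨hav, hloc, h.iInf_maximalIdeal_pow_eq_bot H⟩
    tfae_have 2 → 4 := by
      rintro ⟨hav, hloc, H⟩
      obtain ⟨hVd, hD⟩ := h.isDiscreteValuationRing_of_iInf_pow_eq_bot H
      exact ⟨hVd, hDF.mpr hD, (hAVfield hD).mp hav⟩
    tfae_finish
  · rw [hnoethloc]
    constructor
    · rintro ⟨⟨hVd, hD, hf⟩, hav⟩
      exact ⟨hVd, hD, hf, (hAVfield (hDF.mp hD)).mp hav⟩
    · rintro ⟨hVd, hD, hf, hr⟩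
      exact ⟨⟨hVd, hD, hf⟩, (hAVfield (hDF.mp hD)).mpr hr⟩
  · constructor
    · rintro ⟨hn, hapi⟩
      obtain ⟨hVd, hD, hf⟩ := hnoethloc.mp hn
      exact ⟨hVd, hD, hf, (hAPI.mp ⟨hn.2, hapi⟩).2.2⟩
    · rintro ⟨hVd, hD, hf, hr⟩
      exact ⟨hnoethloc.mpr ⟨hVd, hD, hf⟩, (hAPI.mpr ⟨hVd, hD, hr⟩).2⟩
  · rw [h.isRAVDomain_iff, hDF]
    exact and_congr_right fun _ => and_congr_right fun hD => (hroot hD).symm
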